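/- **Setting.** For an integer $k\ge 1$ let $\mathbb S_k=\mathbb Z^2\times\{0,\dots,k\}$ be the slab, with an edge between any two vertices at Euclidean distance $1$; for $S\subset\mathbb Z^2$ write $\overline S=S\times\{0,\dots,k\}$. For $p\in[0,1]$ let $\mathbf P_p$ be Bernoulli bond percolation on $\mathbb S_k$: each edge is independently open with probability $p$ and closed otherwise. For integers $m,n\ge 1$ let $f_p(m,n)$ be the $\mathbf P_p$-probability that there is an open path from $\overline{\{0\}\times[0,n]}$ to $\overline{\{m\}\times[0,n]}$ inside $\overline{[0,m]\times[0,n]}$ (all intervals being intervals of integers). Let $B_\ell=[-\ell,\ell]^2\subset\mathbb Z^2$ and $A_{\ell,2\ell}=B_{2\ell}\setminus B_\ell$, and let $\mathcal A_{\ell,2\ell}$ be the event that there exists inside $\overline{A_{\ell,2\ell}}$ an open circuit surrounding $\overline{B_\ell}$, that is, a self-avoiding closed open path whose projection onto $\mathbb Z^2$ has nonzero winding number around the origin. **Theorem 3.8.** Fix integers $k\ge 1$ and $r\ge 3$, and fix $\varepsilon\in(0,1]$ such that $\sup_{n\ge 2} f_\varepsilon(2n,n-1)<1/2$. For every $c>0$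 there exist an integer $\lambda\ge 1$ and a real $c'>0$ such that, for every $p\in[\varepsilon,1-\varepsilon]$ and every integer $n\ge 4r$, $$f_p(2n,n-1)\ge c\quad\Longrightarrow\quad \mathbf P_p\big[\mathcal A_{\lambda n,2\lambda n}\big]\ge c'.$$ -/

import Mathlib

open MeasureTheory ProbabilityTheory

/-- The vertex set `ℤ² × {0, …, k}` of the slab of thickness `k`. -/
abbrev SlabVertex (k : ℕ) : Type := ℤ × ℤ × Fin (k + 1)

/-- The slab graph: two vertices are adjacent iff their Euclidean distance is `1`. -/
def slab (k : ℕ) : SimpleGraph (SlabVertex k) where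
  Adj u v := (u.1 - v.1) ^ 2 + (u.2.1 - v.2.1) ^ 2 +
    (((u.2.2 : ℕ) : ℤ) - ((v.2.2 : ℕ) : ℤ)) ^ 2 = 1
  symm := ⟨fun u v h => by rw [← h]; ring⟩
  loopless := ⟨fun u h => by simp at h⟩

/-- For `S ⊆ ℤ²`, the set `S × {0, …, k}` of slab vertices. -/
def slabOver (k : ℕ) (S : Set (ℤ × ℤ)) : Set (SlabVertex k) :=
  {x | (x.1, x.2.1) ∈ S}

/-- Percolation configurations `{0,1}^E`, with `E` the edge set of the slab;
the value `true` means that the edge is open. -/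
abbrev BondConfig (k : ℕ) : Type := (slab k).edgeSet → Bool

/-- Bernoulli bond percolation with density `p`: the edges are independent, and each one is
open with probability `p` and closed with probability `1 - p`. -/
noncomputable def bondPercolation (k : ℕ) (p : unitInterval) : Measure (BondConfig k) :=
  Measure.infinitePi fun _ : (slab k).edgeSet => bernoulliMeasure true false p

/-- The graph formed by the open edges; open paths are the walks of this graph. -/
def openGraph {k : ℕ} (ω : BondConfig k) : SimpleGraph (SlabVertex k) where
  Adj u v := ∃ h : (slab k).Adj u v, ω ⟨s(u, v), h⟩ = true
  symm := ⟨fun u v ⟨h, hω⟩ => by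
    refine ⟨h.symm, ?_⟩
    rw [← hω]
    congr 2
    exact Sym2.eq_swap⟩
  loopless := ⟨fun _ ⟨h, _⟩ => (slab k).irrefl h⟩

/-- The event that there is an open path from `A` to `B` all of whose vertices lie in `R`. -/
def connectedIn (k : ℕ) (R A B : Set (SlabVertex k)) : Set (BondConfig k) :=
  {ω | ∃ u ∈ A, ∃ v ∈ B, ∃ γ : (openGraph ω).Walk u v, ∀ x ∈ γ.support, x ∈ R}

/-- `f_p(m, n)`: the probability that `[0,m] × [0,n] × {0,…,k}` is crossed horizontally, i.e.
contains an open path from its left side `{0} × [0,n] × {0,…,k}` to its right side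
`{m} × [0,n] × {0,…,k}`. -/
noncomputable def crossingProb (k : ℕ) (p : unitInterval) (m n : ℕ) : ℝ :=
  (bondPercolation k p).real
    (connectedIn k (slabOver k (Set.Icc 0 (m : ℤ) ×ˢ Set.Icc 0 (n : ℤ)))
      (slabOver k ({0} ×ˢ Set.Icc 0 (n : ℤ)))
      (slabOver k ({(m : ℤ)} ×ˢ Set.Icc 0 (n : ℤ))))

/-- The square `B_n = [-n,n]²` in `ℤ²`. -/
def planeBox (n : ℕ) : Set (ℤ × ℤ) := Set.Icc (-(n : ℤ)) n ×ˢ Set.Icc (-(n : ℤ)) n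

/-- The annulus `A_{n,m} = B_m \ B_n` in `ℤ²`. -/
def planeAnnulus (n m : ℕ) : Set (ℤ × ℤ) := planeBox m \ planeBox n

/-- The projection of a slab vertex onto `ℤ²`, as a complex number. -/
noncomputable def planeProj {k : ℕ} (x : SlabVertex k) : ℂ := ⟨(x.1 : ℝ), (x.2.1 : ℝ)⟩

/-- The winding number around the origin of the projection onto the plane of a closed path `γ`:
the total variation of the angle along the projected path (the sum of its signed increments,
each one in `(-π, π]`), divided by `2π`. It is meant for paths whose projection avoids the origin;
as every step of the projection has length `0` or `1`, no step then passes through the origin,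
and every increment is in `(-π, π)`. -/
noncomputable def windingNumber {k : ℕ} {G : SimpleGraph (SlabVertex k)} {v : SlabVertex k}
    (γ : G.Walk v v) : ℝ :=
  (γ.darts.map fun d => Complex.arg (planeProj d.snd / planeProj d.fst)).sum / (2 * Real.pi)

/-- The event that there is an open circuit in `A_{l,2l} × {0,…,k}` surrounding
`B_l × {0,…,k}`: a self-avoiding closed open path in the annulus whose projection has nonzero
winding number around the origin (equivalently, as the path avoids `B_l × {0,…,k}`, around any
point of `B_l`). -/
def circuitEvent (k l : ℕ) : Set (BondConfig k) :=
  {ω | ∃ (v : SlabVertex k) (γ : (openGraph ω).Walk v v), γ.IsCycle ∧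
    (∀ x ∈ γ.support, x ∈ slabOver k (planeAnnulus l (2 * l))) ∧ windingNumber γ ≠ 0}

/-! Cut `ℤ²` into cells of `n × n` points. A crossing of the given rectangle contains a lengthwise
crossing of a domino of two adjacent cells, so by the symmetries of the slab every domino is crossed
with probability at least `c` (`crossingProb_le_domino`). String dominoes along a path of cells that
turns at every cell: two consecutive crossings traverse their common cell in perpendicular
directions, so their projections meet there (`exists_mem_of_crossing`), although in the slab one
path may pass above the other.

The gluing inequality `prob_le_of_forcedCrossing` makes them really meet, at a bounded cost in
probability. If they do not meet, take a column over the common cell and a vertex of each path on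
it, as close as possible, open the vertical segment between the two and close the other edges at its
interior vertices. Only edges at one column change, at most `9 * (k + 1) ^ 2` of them. The map has
bounded fibres once that column can be read off its image. To this end both paths are chosen
greedily, for an order in which a step down always comes last, and the path through the upper end of
the bridge serves as reference: the bridge does not alter it, and afterwards the upper end is the
only vertex over the cell at which the other cluster is attached to it (`attached_bridged`).

With Harris' inequality this produces a right and a left arc around the annulus (`prob_cellPath`),
and glues them in the top cell into a joint, a vertex from which both arcs lead to the bottom cell.
The closing step at the bottom (`prob_joint_le`) is more delicate, since both connections now start
at the same joint, which must be recovered from the image as well. It is the least joint linked to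
itself there; the configurations for which this rule would fail are already doubly linked. A double
link is a closed walk that turns twice around the origin, and a simple cycle with nonzero winding
number is extracted from it (`exists_isCycle_of_walkSum_ne_zero`). All cells used lie in
`A_{3n,6n}`, whence the factor 3. -/

namespace SlabPercolation

/-! ### Canonical greedy paths between two sets -/

section Greedy

variable {V K : Type*} [LinearOrder K]

/-- `y` can be reached from `x` along edges in `T`. -/
def Reach (T : Set (Sym2 V)) : V → V → Prop :=
  Relation.ReflTransGen fun a b => s(a, b) ∈ T

theorem Reach.refl {T : Set (Sym2 V)} (x : V) : Reach T x x := Relation.ReflTransGen.refl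

theorem Reach.trans {T : Set (Sym2 V)} {x y z : V} (h : Reach T x y) (h' : Reach T y z) :
    Reach T x z := Relation.ReflTransGen.trans h h'

theorem Reach.symm {T : Set (Sym2 V)} {x y : V} (h : Reach T x y) : Reach T y x := by
  induction h with
  | refl => exact Relation.ReflTransGen.refl
  | tail _ hbc ih => exact Relation.ReflTransGen.head (by rwa [Sym2.eq_swap]) ih

theorem Reach.mono {T T' : Set (Sym2 V)} (hT : T ⊆ T') {x y : V} (h : Reach T x y) :
    Reach T' x y := Relation.ReflTransGen.mono (fun _ _ hab => hT hab) _ _ h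

theorem Reach.single {T : Set (Sym2 V)} {x y : V} (h : s(x, y) ∈ T) : Reach T x y :=
  Relation.ReflTransGen.single h

/-- `x` is connected to `B` along edges in `T`, through vertices outside `vis`. -/
def ReachAvoid (T : Set (Sym2 V)) (B vis : Set V) (x : V) : Prop :=
  x ∉ vis ∧ ∃ b ∈ B, Relation.ReflTransGen (fun a c => s(a, c) ∈ T ∧ c ∉ vis) x b

theorem ReachAvoid.head {T : Set (Sym2 V)} {B vis : Set V} {x y : V} (hx : x ∉ vis)
    (h : s(x, y) ∈ T) (hy : ReachAvoid T B vis y) : ReachAvoid T B vis x := by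
  obtain ⟨hy, b, hb, hyb⟩ := hy
  exact ⟨hx, b, hb, Relation.ReflTransGen.head ⟨h, hy⟩ hyb⟩

theorem reachAvoid_of_mem {T : Set (Sym2 V)} {B vis : Set V} {x : V} (hx : x ∉ vis)
    (h : x ∈ B) : ReachAvoid T B vis x := ⟨hx, x, h, Relation.ReflTransGen.refl⟩

/-- An induction principle: the property is checked on `B` and propagated backwards. -/
theorem ReachAvoid.backward {T : Set (Sym2 V)} {B vis : Set V} {P : V → Prop} {x : V}
    (h : ReachAvoid T B vis x) (base : ∀ b ∈ B, b ∉ vis → P b)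
    (step : ∀ a c, a ∉ vis → s(a, c) ∈ T → ReachAvoid T B vis c → P c → P a) : P x := by
  obtain ⟨hx, b, hb, hxb⟩ := h
  revert hx
  induction hxb using Relation.ReflTransGen.head_induction_on with
  | refl => exact base b hb
  | head h1 h2 ih => exact fun ha => step _ _ ha h1.1 ⟨h1.2, b, hb, h2⟩ (ih h1.2)

theorem reachAvoid_empty {T : Set (Sym2 V)} {B : Set V} {x : V}
    (h : ∃ b ∈ B, Reach T x b) : ReachAvoid T B ∅ x := by
  obtain ⟨b, hb, hxb⟩ := h
  exact ⟨Set.notMem_empty x, b, hb,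
    Relation.ReflTransGen.mono (fun _ c h => ⟨h, Set.notMem_empty c⟩) _ _ hxb⟩

/-- The possible next steps from `x` towards `B`. -/
def Cand (T : Set (Sym2 V)) (B vis : Set V) (x : V) : Set V :=
  {y | s(x, y) ∈ T ∧ ReachAvoid T B vis y}

/-- On a connection from `x` to `B`, the step after the last visit to `x` leads to a vertex from
which `B` is reached without returning to `x`. Hence the greedy path never gets stuck. -/
theorem exists_cand {T : Set (Sym2 V)} {B vis : Set V} {x : V} (h : ReachAvoid T B vis x)
    (hx : x ∉ B) : ∃ y, y ∈ Cand T B (insert x vis) x := by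
  have key : ReachAvoid T B (insert x vis) x ∨ ∃ y, y ∈ Cand T B (insert x vis) x := by
    refine h.backward (P := fun t => ReachAvoid T B (insert x vis) t ∨
      ∃ y, y ∈ Cand T B (insert x vis) x) ?_ ?_
    · intro b hb hbv
      refine Or.inl (reachAvoid_of_mem ?_ hb)
      rintro (rfl | h')
      · exact hx hb
      · exact hbv h'
    · rintro a c ha hac - hc
      rcases hc with hc | hc
      · by_cases hax : a = x
        · subst hax
          exact Or.inr ⟨c, hac, hc⟩
        · refine Or.inl (hc.head ?_ hac)
          rintro (h' | h')
          · exact hax h'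
          · exact ha h'
      · exact Or.inr hc
  rcases key with h' | h'
  · exact absurd (Set.mem_insert x vis) h'.1
  · exact h'

/-- `Greedy key T B vis x l` says that `l` is the path from `x` to `B` outside `vis` which at every
vertex takes the candidate with the least key, until it hits `B`. -/
inductive Greedy (key : V → K) (T : Set (Sym2 V)) (B : Set V) : Set V → V → List V → Prop
  | base {vis : Set V} {x : V} (hx : x ∈ B) : Greedy key T B vis x [x]
  | step {vis : Set V} {x y : V} {l : List V} (hx : x ∉ B)
      (hy : y ∈ Cand T B (insert x vis) x)
      (hmin : ∀ y' ∈ Cand T B (insert x vis) x, key y ≤ key y')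
      (hl : Greedy key T B (insert x vis) y l) : Greedy key T B vis x (x :: l)

variable {key : V → K} {T : Set (Sym2 V)} {B : Set V}

theorem Greedy.head {vis : Set V} {x : V} {l : List V} (h : Greedy key T B vis x l) :
    ∃ l', l = x :: l' := by
  cases h with
  | base => exact ⟨_, rfl⟩
  | step => exact ⟨_, rfl⟩

theorem Greedy.unique (hkey : Function.Injective key) {vis : Set V} {x : V} {l l' : List V}
    (h : Greedy key T B vis x l) (h' : Greedy key T B vis x l') : l = l' := by
  induction h generalizing l' with
  | base hx =>
    cases h' with
    | base => rfl
    | step hx' => exact absurd hx hx'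
  | step hx hy hmin hl ih =>
    cases h' with
    | base hx' => exact absurd hx' hx
    | step hx' hy' hmin' hl' =>
      have := hkey (le_antisymm (hmin _ hy') (hmin' _ hy))
      subst this
      rw [ih hl']

theorem Greedy.isChain {vis : Set V} {x : V} {l : List V} (h : Greedy key T B vis x l) :
    l.IsChain fun a b => s(a, b) ∈ T := by
  induction h with
  | base hx => exact List.isChain_singleton _
  | step hx hy hmin hl ih =>
    obtain ⟨l', rfl⟩ := hl.head
    exact List.isChain_cons_cons.2 ⟨hy.1, ih⟩

theorem Greedy.getLast {vis : Set V} {x : V} {l : List V} (h : Greedy key T B vis x l) :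
    ∃ b ∈ B, l.getLast? = some b := by
  induction h with
  | base hx => exact ⟨_, hx, rfl⟩
  | step hx hy hmin hl ih =>
    obtain ⟨l', rfl⟩ := hl.head
    obtain ⟨b, hb, hb'⟩ := ih
    exact ⟨b, hb, by rw [List.getLast?_cons_cons, hb']⟩

theorem Greedy.reach {vis : Set V} {x : V} {l : List V} (h : Greedy key T B vis x l) :
    ∀ t ∈ l, Reach T x t := by
  induction h with
  | base hx =>
    intro t ht
    rw [List.mem_singleton.1 ht]
    exact Reach.refl _
  | step hx hy hmin hl ih =>
    intro t ht
    rcases List.mem_cons.1 ht with rfl | ht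
    · exact Reach.refl _
    · exact (Reach.single hy.1).trans (ih t ht)

theorem Greedy.reachAvoid {vis : Set V} {x : V} {l : List V} (h : Greedy key T B vis x l)
    (hx : x ∉ vis) : ∀ t ∈ l, ReachAvoid T B vis t := by
  induction h with
  | base hb =>
    intro t ht
    rw [List.mem_singleton.1 ht]
    exact reachAvoid_of_mem hx hb
  | @step vis x y l hxB hy hmin hl ih =>
    have h2 := ih hy.2.1
    have mono : ∀ t, ReachAvoid T B (insert x vis) t → ReachAvoid T B vis t := by
      rintro t ⟨h3, b, hb, htb⟩
      exact ⟨fun h => h3 (Or.inr h), b, hb, Relation.ReflTransGen.mono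
        (fun _ c h => ⟨h.1, fun h' => h.2 (Or.inr h')⟩) _ _ htb⟩
    intro t ht
    rcases List.mem_cons.1 ht with rfl | ht
    · exact (mono _ hy.2).head hx hy.1
    · exact mono t (h2 t ht)

theorem Greedy.exists_of_reachAvoid [WellFoundedLT K] (key : V → K)
    (hfin : {x | ∃ y, s(x, y) ∈ T}.Finite) {vis : Set V} {x : V} (h : ReachAvoid T B vis x) :
    ∃ l, Greedy key T B vis x l := by
  -- The induction is on the number of unvisited vertices that are incident to `T`.
  obtain ⟨N, hN⟩ : ∃ N, ({x | ∃ y, s(x, y) ∈ T} \ vis).ncard = N := ⟨_, rfl⟩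
  induction N using Nat.strong_induction_on generalizing vis x with
  | _ N ih =>
    by_cases hx : x ∈ B
    · exact ⟨[x], Greedy.base hx⟩
    · obtain ⟨y, hy, hmin⟩ : ∃ y ∈ Cand T B (insert x vis) x,
          ∀ y' ∈ Cand T B (insert x vis) x, key y ≤ key y' := by
        obtain ⟨m, ⟨y, hy, rfl⟩, hm⟩ := WellFounded.has_min (wellFounded_lt (α := K))
          (key '' Cand T B (insert x vis) x) (Set.Nonempty.image _ (exists_cand h hx))
        exact ⟨y, hy, fun y' hy' => not_lt.1 (hm _ ⟨y', hy', rfl⟩)⟩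
      have hlt : ({x | ∃ y, s(x, y) ∈ T} \ insert x vis).ncard < N := by
        rw [← hN]
        refine Set.ncard_lt_ncard ?_ (hfin.subset Set.sdiff_subset)
        refine ⟨Set.sdiff_subset_sdiff_right (Set.subset_insert _ _), fun hsub => ?_⟩
        exact (hsub ⟨⟨y, hy.1⟩, h.1⟩).2 (Set.mem_insert _ _)
      obtain ⟨l, hl⟩ := ih _ hlt hy.2 rfl
      exact ⟨x :: l, Greedy.step hx hy hmin hl⟩

/-- The greedy path from `A` to `B`, started at the vertex of `A` with the least key. -/
def GreedyFrom (key : V → K) (T : Set (Sym2 V)) (A B : Set V) (l : List V) : Prop :=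
  ∃ a ∈ A, ReachAvoid T B ∅ a ∧ (∀ a' ∈ A, ReachAvoid T B ∅ a' → key a ≤ key a') ∧
    Greedy key T B ∅ a l

variable {A : Set V}

theorem GreedyFrom.unique (hkey : Function.Injective key) {l l' : List V}
    (h : GreedyFrom key T A B l) (h' : GreedyFrom key T A B l') : l = l' := by
  obtain ⟨a, ha, har, hmin, hl⟩ := h
  obtain ⟨a', ha', har', hmin', hl'⟩ := h'
  have := hkey (le_antisymm (hmin _ ha' har') (hmin' _ ha har))
  subst this
  exact hl.unique hkey hl'

theorem GreedyFrom.exists [WellFoundedLT K] (key : V → K)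
    (hfin : {x | ∃ y, s(x, y) ∈ T}.Finite) (h : ∃ a ∈ A, ∃ b ∈ B, Reach T a b) :
    ∃ l, GreedyFrom key T A B l := by
  obtain ⟨a₀, ha₀, h₀⟩ := h
  obtain ⟨m, ⟨a, ⟨ha, har⟩, rfl⟩, hm⟩ := WellFounded.has_min (wellFounded_lt (α := K))
    (key '' {a | a ∈ A ∧ ReachAvoid T B ∅ a})
    (Set.Nonempty.image _ ⟨a₀, ha₀, reachAvoid_empty h₀⟩)
  obtain ⟨l, hl⟩ := Greedy.exists_of_reachAvoid key hfin har
  exact ⟨l, a, ha, har, fun a' ha' h' => not_lt.1 (hm _ ⟨a', ⟨ha', h'⟩, rfl⟩), hl⟩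

theorem GreedyFrom.reach {l : List V} (h : GreedyFrom key T A B l) :
    ∀ t ∈ l, ∃ a ∈ A, Reach T a t := by
  obtain ⟨a, ha, -, -, hl⟩ := h
  exact fun t ht => ⟨a, ha, hl.reach t ht⟩

end Greedy

/-! ### The order on slab vertices, and vertical bridges -/

variable {k : ℕ}

/-- The projection of a slab vertex onto `ℤ²`. -/
def col (x : SlabVertex k) : ℤ × ℤ := (x.1, x.2.1)

/-- The height of a slab vertex. -/
def ht (x : SlabVertex k) : ℕ := x.2.2

theorem ht_le (x : SlabVertex k) : ht x ≤ k := Nat.lt_succ_iff.1 x.2.2.2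

theorem ext_col_ht {x y : SlabVertex k} (h : col x = col y) (h' : ht x = ht y) : x = y := by
  obtain ⟨x1, x2, x3⟩ := x
  obtain ⟨y1, y2, y3⟩ := y
  simp only [col, ht, Prod.mk.injEq] at h h'
  obtain ⟨rfl, rfl⟩ := h
  rw [Fin.ext h']

/-- The key of a slab vertex: among the neighbours of a vertex, the one below it is the largest. -/
def slabKey (x : SlabVertex k) : ℕ ×ₗ ℕ := toLex (k - ht x, Encodable.encode (col x))

theorem slabKey_injective : Function.Injective (slabKey (k := k)) := by
  intro x y h
  have h' : (k - ht x, Encodable.encode (col x)) = (k - ht y, Encodable.encode (col y)) :=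
    toLex.injective h
  rw [Prod.mk.injEq] at h'
  refine ext_col_ht (Encodable.encode_injective h'.2) ?_
  have := ht_le x
  have := ht_le y
  omega

/-- The first coordinate of the key decreases with the height, and the vertex below is the only
neighbour of `u` that is lower than `u`. A newly opened edge downwards is therefore never preferred
to an existing candidate. -/
theorem slabKey_le_of_adj {u y d : SlabVertex k} (h : (slab k).Adj u y) (hd : col d = col u)
    (hdu : ht u = ht d + 1) : slabKey y ≤ slabKey d := by
  have h : (u.1 - y.1) ^ 2 + (u.2.1 - y.2.1) ^ 2 + ((ht u : ℤ) - (ht y : ℤ)) ^ 2 = 1 := h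
  by_cases hlt : ht u ≤ ht y
  · refine le_of_lt (Prod.Lex.toLex_lt_toLex.2 (Or.inl ?_))
    have := ht_le y
    have := ht_le d
    dsimp only
    omega
  · have h1 : (1 : ℤ) ≤ ((ht u : ℤ) - (ht y : ℤ)) := by omega
    have h2 : ((ht u : ℤ) - (ht y : ℤ)) = 1 := by nlinarith [sq_nonneg (u.1 - y.1), sq_nonneg (u.2.1 - y.2.1)]
    rw [h2] at h
    have h3 : u.1 - y.1 = 0 := by nlinarith [sq_nonneg (u.1 - y.1), sq_nonneg (u.2.1 - y.2.1)]
    have h4 : u.2.1 - y.2.1 = 0 := by nlinarith [sq_nonneg (u.1 - y.1), sq_nonneg (u.2.1 - y.2.1)]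
    have : y = d := by
      refine ext_col_ht (hd.symm ▸ ?_) (by omega)
      simp only [col, Prod.mk.injEq]
      omega
    rw [this]

/-- The vertices strictly between `v` and `u`, where `v` lies below `u`. -/
def between (u v : SlabVertex k) : Set (SlabVertex k) :=
  {x | col x = col u ∧ ht v < ht x ∧ ht x < ht u}

/-- The edges of the vertical segment from `v` up to `u`. -/
def segment (u v : SlabVertex k) : Set (Sym2 (SlabVertex k)) :=
  {e | ∃ x y, e = s(x, y) ∧ col x = col u ∧ col y = col u ∧ ht y = ht x + 1 ∧
    ht v ≤ ht x ∧ ht y ≤ ht u}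

/-- The configuration in which the segment between `u` and `v` is opened and the other edges at its
interior vertices are closed. -/
def bridged (S : Set (Sym2 (SlabVertex k))) (u v : SlabVertex k) : Set (Sym2 (SlabVertex k)) :=
  (S \ {e | ∃ x ∈ e, x ∈ between u v}) ∪ segment u v

theorem mem_segment {u v x y : SlabVertex k} (h : s(x, y) ∈ segment u v) :
    col x = col u ∧ col y = col u ∧ ht v ≤ ht x ∧ ht v ≤ ht y ∧ ht x ≤ ht u ∧ ht y ≤ ht u ∧
      (ht y = ht x + 1 ∨ ht x = ht y + 1) := by
  obtain ⟨a, b, hab, h1, h2, h3, h4, h5⟩ := h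
  rcases Sym2.eq_iff.1 hab with ⟨rfl, rfl⟩ | ⟨rfl, rfl⟩
  · exact ⟨h1, h2, h4, by omega, by omega, h5, Or.inl h3⟩
  · exact ⟨h2, h1, by omega, by omega, by omega, by omega, Or.inr h3⟩

theorem segment_cases {u v x : SlabVertex k} (huv : col v = col u) (hx : col x = col u)
    (h1 : ht v ≤ ht x) (h2 : ht x ≤ ht u) : x = u ∨ x = v ∨ x ∈ between u v := by
  rcases eq_or_lt_of_le h1 with h1 | h1
  · exact Or.inr (Or.inl (ext_col_ht (hx.trans huv.symm) h1.symm))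
  · rcases eq_or_lt_of_le h2 with h2 | h2
    · exact Or.inl (ext_col_ht hx h2)
    · exact Or.inr (Or.inr ⟨hx, h1, h2⟩)

theorem bridged_cases {S : Set (Sym2 (SlabVertex k))} {u v x y : SlabVertex k}
    (h : s(x, y) ∈ bridged S u v) :
    s(x, y) ∈ segment u v ∨ (s(x, y) ∈ S ∧ x ∉ between u v ∧ y ∉ between u v) := by
  rcases h with h | h
  · exact Or.inr ⟨h.1, fun h' => h.2 ⟨x, by simp, h'⟩, fun h' => h.2 ⟨y, by simp, h'⟩⟩
  · exact Or.inl h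

theorem mem_bridged {S : Set (Sym2 (SlabVertex k))} {u v x y : SlabVertex k}
    (h : s(x, y) ∈ S) (hx : x ∉ between u v) (hy : y ∉ between u v) :
    s(x, y) ∈ bridged S u v := by
  refine Or.inl ⟨h, ?_⟩
  rintro ⟨t, ht, ht'⟩
  rcases Sym2.mem_iff.1 ht with rfl | rfl
  · exact hx ht'
  · exact hy ht'

theorem reach_segment {D : Set (Sym2 (SlabVertex k))} {u v : SlabVertex k} (huv : col v = col u)
    (hlt : ht v ≤ ht u) (hD : segment u v ⊆ D) : Reach D v u := by
  have key : ∀ d : ℕ, ∀ x : SlabVertex k, col x = col u → ht v ≤ ht x → ht x + d = ht u →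
      Reach D x u := by
    intro d
    induction d with
    | zero =>
      intro x hx _ hd
      rw [ext_col_ht hx hd]
      exact Reach.refl u
    | succ d ih =>
      intro x hx hvx hd
      have hk := ht_le u
      let y : SlabVertex k := (x.1, x.2.1, ⟨ht x + 1, by omega⟩)
      have hy : col y = col u := hx
      have hy' : ht y = ht x + 1 := rfl
      exact (Reach.single (hD ⟨x, y, rfl, hx, hy, hy', hvx, by omega⟩)).trans
        (ih y hy (by omega) (by omega))
  exact key (ht u - ht v) v huv le_rfl (by omega)

/-- A connection in the bridged configuration either is one in the original configuration, or
starts with one that leads to an end of the bridge. -/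
theorem reach_bridged_cases {S D : Set (Sym2 (SlabVertex k))} {u v x y : SlabVertex k}
    (huv : col v = col u) (h : Reach (bridged S u v ∩ D) x y) (hx : x ∉ between u v) :
    (Reach (S ∩ D) x y ∧ y ∉ between u v) ∨ Reach (S ∩ D) x u ∨ Reach (S ∩ D) x v := by
  induction h with
  | refl => exact Or.inl ⟨Reach.refl x, hx⟩
  | @tail y z hy hyz ih =>
    rcases ih with ⟨h1, h2⟩ | h1
    · rcases bridged_cases hyz.1 with hs | ⟨hs, -, hz⟩
      · obtain ⟨hc, -, ha, -, hb, -, -⟩ := mem_segment hs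
        rcases segment_cases huv hc ha hb with rfl | rfl | hbet
        · exact Or.inr (Or.inl h1)
        · exact Or.inr (Or.inr h1)
        · exact absurd hbet h2
      · exact Or.inl ⟨h1.trans (Reach.single ⟨hs, hyz.2⟩), hz⟩
    · exact Or.inr h1

theorem reach_bridged_of_chain {S D : Set (Sym2 (SlabVertex k))} {u v x y : SlabVertex k}
    {l : List (SlabVertex k)} (h : (x :: l).IsChain fun a b => s(a, b) ∈ S ∩ D)
    (hl : ∀ t ∈ x :: l, t ∉ between u v) (hy : y ∈ x :: l) :
    Reach (bridged S u v ∩ D) x y := by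
  induction l generalizing x with
  | nil =>
    rw [List.mem_singleton.1 hy]
    exact Reach.refl x
  | cons z l ih =>
    rcases List.mem_cons.1 hy with rfl | hy
    · exact Reach.refl _
    · obtain ⟨h1, h2⟩ := List.isChain_cons_cons.1 h
      have hs : s(x, z) ∈ bridged S u v ∩ D :=
        ⟨mem_bridged h1.1 (hl _ (by simp)) (hl _ (by simp)), h1.2⟩
      exact (Reach.single hs).trans
        (ih h2 (fun t ht => hl t (List.mem_cons_of_mem _ ht)) hy)

/-! ### Invariance of the reference path under the bridge -/

section Reference

variable {S D₁ D₂ : Set (Sym2 (SlabVertex k))} {A B C : Set (SlabVertex k)} {Q : Set (ℤ × ℤ)}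
  {u v : SlabVertex k}

/-- Since the lower end `v` is not connected to `A`, a connection from a vertex reachable from `A`
can enter the bridge only at `u`. If `u` is already visited this is forbidden; otherwise `u` has its
own connection to `B` in the original configuration, which replaces the rest. -/
theorem reachAvoid_of_bridged {vis : Set (SlabVertex k)} (huv : col v = col u)
    (hv : ¬∃ a ∈ A, Reach (S ∩ D₁) a v) (hu : u ∈ vis ∨ ReachAvoid (S ∩ D₁) B vis u)
    {t : SlabVertex k} (ht : ReachAvoid (bridged S u v ∩ D₁) B vis t)
    (hAt : ∃ a ∈ A, Reach (S ∩ D₁) a t) (htb : t ∉ between u v) :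
    ReachAvoid (S ∩ D₁) B vis t := by
  revert hAt htb
  refine ht.backward (P := fun t => (∃ a ∈ A, Reach (S ∩ D₁) a t) → t ∉ between u v →
    ReachAvoid (S ∩ D₁) B vis t) (fun b hb hbv _ _ => reachAvoid_of_mem hbv hb) ?_
  rintro t t' htv hs - ih ⟨a, ha, hat⟩ htb
  rcases bridged_cases hs.1 with hseg | ⟨hS, -, ht'⟩
  · obtain ⟨hc, -, h1, -, h2, -, -⟩ := mem_segment hseg
    rcases segment_cases huv hc h1 h2 with rfl | rfl | hbet
    · exact hu.resolve_left htv
    · exact absurd ⟨a, ha, hat⟩ hv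
    · exact absurd hbet htb
  · exact (ih ⟨a, ha, hat.trans (Reach.single ⟨hS, hs.2⟩)⟩ ht').head htv ⟨hS, hs.2⟩

/-- At each vertex the bridge creates no better candidate: away from `u` the candidates after
bridging were candidates before, and at `u` the only new edge points down, where the key is largest.
-/
theorem Greedy.bridged (hD : ∀ x y, s(x, y) ∈ D₁ → (slab k).Adj x y) (huv : col v = col u)
    (hv : ¬∃ a ∈ A, Reach (S ∩ D₁) a v) {vis : Set (SlabVertex k)} {x : SlabVertex k}
    {l : List (SlabVertex k)} (h : Greedy slabKey (S ∩ D₁) B vis x l)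
    (hxv : x ∉ vis) (hl : ∀ t ∈ l, t ∉ between u v) (hx : ∃ a ∈ A, Reach (S ∩ D₁) a x)
    (hu : u ∈ vis ∨ u ∈ l) : Greedy slabKey (bridged S u v ∩ D₁) B vis x l := by
  induction h with
  | base hxB => exact Greedy.base hxB
  | @step vis x y l hxB hy hmin hg ih =>
    obtain ⟨a, ha, hax⟩ := hx
    have hay : Reach (S ∩ D₁) a y := hax.trans (Reach.single hy.1)
    have hxb : x ∉ between u v := hl _ (by simp)
    have hyl : y ∈ l := by
      obtain ⟨l', rfl⟩ := hg.head
      simp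
    have hyb : y ∉ between u v := hl _ (List.mem_cons_of_mem _ hyl)
    have hu' : u ∈ insert x vis ∨ u ∈ l := by
      rcases hu with h | h
      · exact Or.inl (Or.inr h)
      · rcases List.mem_cons.1 h with h | h
        · exact Or.inl (Or.inl h)
        · exact Or.inr h
    have hg' := ih hy.2.1 (fun t ht => hl t (List.mem_cons_of_mem _ ht)) ⟨a, ha, hay⟩ hu'
    refine Greedy.step hxB ⟨⟨mem_bridged hy.1.1 hxb hyb, hy.1.2⟩,
      hg'.reachAvoid hy.2.1 y hyl⟩ ?_ hg'
    rintro y' ⟨hs, hy'⟩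
    rcases bridged_cases hs.1 with hseg | ⟨hS, -, hyb'⟩
    · obtain ⟨hc, hc', h1, h1', h2, h2', h3⟩ := mem_segment hseg
      rcases segment_cases huv hc h1 h2 with rfl | rfl | hbet
      -- Here `x` is `u`, and `y'` is the vertex just below it.
      · refine slabKey_le_of_adj (hD _ _ hy.1.2) hc' ?_
        omega
      · exact absurd ⟨a, ha, hax⟩ hv
      · exact absurd hbet hxb
    · refine hmin y' ⟨⟨hS, hs.2⟩, reachAvoid_of_bridged huv hv ?_ hy'
        ⟨a, ha, hax.trans (Reach.single ⟨hS, hs.2⟩)⟩ hyb'⟩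
      rcases hu' with h | h
      · exact Or.inl h
      · exact Or.inr (hg.reachAvoid hy.2.1 u h)

theorem GreedyFrom.bridged (hD : ∀ x y, s(x, y) ∈ D₁ → (slab k).Adj x y) (huv : col v = col u)
    (hv : ¬∃ a ∈ A, Reach (S ∩ D₁) a v) (hA : ∀ a ∈ A, a ∉ between u v)
    {l : List (SlabVertex k)} (h : GreedyFrom slabKey (S ∩ D₁) A B l)
    (hl : ∀ t ∈ l, t ∉ between u v) (hu : u ∈ l) :
    GreedyFrom slabKey (bridged S u v ∩ D₁) A B l := by
  obtain ⟨a, ha, har, hmin, hg⟩ := h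
  have hg' := hg.bridged hD huv hv (Set.notMem_empty a) hl ⟨a, ha, Reach.refl a⟩ (Or.inr hu)
  have hal : a ∈ l := by
    obtain ⟨l', rfl⟩ := hg.head
    simp
  refine ⟨a, ha, hg'.reachAvoid (Set.notMem_empty a) a hal, fun a' ha' h' => hmin a' ha' ?_, hg'⟩
  exact reachAvoid_of_bridged huv hv (Or.inr (hg.reachAvoid (Set.notMem_empty a) u hu)) h'
    ⟨a', ha', Reach.refl a'⟩ (hA a' ha')

/-- `y` is a vertex over `Q` of the greedy path from `A` to `B` in `T₁` which is connected to `C` in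
`T₂` by a path that meets the greedy path over `Q` only at `y`. -/
def Attached (T₁ T₂ : Set (Sym2 (SlabVertex k))) (A B C : Set (SlabVertex k)) (Q : Set (ℤ × ℤ))
    (y : SlabVertex k) : Prop :=
  ∃ l, GreedyFrom slabKey T₁ A B l ∧ y ∈ l ∧ col y ∈ Q ∧
    ∃ c ∈ C, Relation.ReflTransGen (fun a b => s(a, b) ∈ T₂ ∧ ¬(a ∈ l ∧ col a ∈ Q)) c y

/-- This is what makes the surgery reversible. Before it, no vertex of the reference path over `Q`
is connected to `C`; the bridge opens a single access, which arrives at its upper end `u`. So `u`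
can be recognised in the modified configuration. -/
theorem attached_bridged (hD : ∀ x y, s(x, y) ∈ D₁ → (slab k).Adj x y)
    (hseg : segment u v ⊆ D₂) (huv : col v = col u) (hlt : ht v < ht u) (huQ : col u ∈ Q)
    (hA : ∀ a ∈ A, col a ∉ Q) (hC : ∀ c ∈ C, col c ∉ Q)
    (hY : ∀ w, col w ∈ Q → (∃ a ∈ A, Reach (S ∩ D₁) a w) → ¬∃ c ∈ C, Reach (S ∩ D₂) c w)
    {l l₂ : List (SlabVertex k)} (h : GreedyFrom slabKey (S ∩ D₁) A B l)
    (hl : ∀ t ∈ l, t ∉ between u v) (hu : u ∈ l) {c : SlabVertex k} (hc : c ∈ C)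
    (h₂ : (c :: l₂).IsChain fun a b => s(a, b) ∈ S ∩ D₂)
    (hl₂ : ∀ t ∈ c :: l₂, t ∉ between u v) (hv : v ∈ c :: l₂) :
    GreedyFrom slabKey (bridged S u v ∩ D₁) A B l ∧
    Attached (bridged S u v ∩ D₁) (bridged S u v ∩ D₂) A B C Q u ∧
    ∀ y, Attached (bridged S u v ∩ D₁) (bridged S u v ∩ D₂) A B C Q y → y = u := by
  have hcv : ∀ t ∈ c :: l₂, Reach (S ∩ D₂) c t := by
    clear hl₂ hv hc
    induction l₂ generalizing c with
    | nil => 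
      intro t ht
      rw [List.mem_singleton.1 ht]
      exact Reach.refl c
    | cons d l₂ ih =>
      intro t ht
      obtain ⟨h1, h2⟩ := List.isChain_cons_cons.1 h₂
      rcases List.mem_cons.1 ht with rfl | ht
      · exact Reach.refl _
      · exact (Reach.single h1).trans (ih h2 t ht)
  have hvA : ¬∃ a ∈ A, Reach (S ∩ D₁) a v := fun hv' =>
    hY v (huv ▸ huQ) hv' ⟨c, hc, hcv v hv⟩
  have hA' : ∀ a ∈ A, a ∉ between u v := fun a ha h' => hA a ha (h'.1 ▸ huQ)
  have hC' : ∀ a ∈ C, a ∉ between u v := fun a ha h' => hC a ha (h'.1 ▸ huQ)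
  have hg := h.bridged hD huv hvA hA' hl hu
  have hnotl : ∀ t, t ∈ l → col t ∈ Q → ¬∃ c ∈ C, Reach (S ∩ D₂) c t := fun t ht htQ =>
    hY t htQ (h.reach t ht)
  refine ⟨hg, ⟨l, hg, hu, huQ, c, hc, ?_⟩, ?_⟩
  · have key : ∀ x ∈ c :: l₂, Relation.ReflTransGen (fun a b => s(a, b) ∈ bridged S u v ∩ D₂ ∧
        ¬(a ∈ l ∧ col a ∈ Q)) c x := by
      have hoff : ∀ t ∈ c :: l₂, ¬(t ∈ l ∧ col t ∈ Q) := fun t ht h' =>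
        hnotl t h'.1 h'.2 ⟨c, hc, hcv t ht⟩
      clear hcv hv hc
      induction l₂ generalizing c with
      | nil =>
        intro x hx
        rw [List.mem_singleton.1 hx]
      | cons d l₂ ih =>
        intro x hx
        obtain ⟨h1, h2⟩ := List.isChain_cons_cons.1 h₂
        rcases List.mem_cons.1 hx with rfl | hx
        · exact Relation.ReflTransGen.refl
        · refine Relation.ReflTransGen.head ⟨⟨mem_bridged h1.1 (hl₂ _ (by simp))
            (hl₂ _ (by simp)), h1.2⟩, hoff _ (by simp)⟩ ?_
          exact ih h2 (fun t ht => hl₂ t (List.mem_cons_of_mem _ ht))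
            (fun t ht => hoff t (List.mem_cons_of_mem _ ht)) x hx
    refine (key v hv).trans ?_
    have up : ∀ d : ℕ, ∀ x : SlabVertex k, col x = col u → ht v ≤ ht x → ht x + d = ht u →
        Relation.ReflTransGen (fun a b => s(a, b) ∈ bridged S u v ∩ D₂ ∧
          ¬(a ∈ l ∧ col a ∈ Q)) x u := by
      intro d
      induction d with
      | zero =>
        intro x hx _ hd
        rw [ext_col_ht hx hd]
      | succ d ih =>
        intro x hx hvx hd
        have hk := ht_le u
        let y : SlabVertex k := (x.1, x.2.1, ⟨ht x + 1, by omega⟩)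
        have hy : col y = col u := hx
        have hy' : ht y = ht x + 1 := rfl
        have hs : s(x, y) ∈ segment u v := ⟨x, y, rfl, hx, hy, hy', hvx, by omega⟩
        refine Relation.ReflTransGen.head ⟨⟨Or.inr hs, hseg hs⟩, ?_⟩
          (ih y hy (by omega) (by omega))
        rintro ⟨hxl, hxQ⟩
        rcases segment_cases huv hx hvx (by omega) with rfl | rfl | hbet
        · omega
        · exact hnotl _ hxl hxQ ⟨c, hc, hcv _ hv⟩
        · exact hl _ hxl hbet
    exact up (ht u - ht v) v huv le_rfl (by omega)
  · rintro y ⟨l', hl', hyl, hyQ, c', hc', hpath⟩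
    obtain rfl := hl'.unique slabKey_injective hg
    -- An attaching path stays in the original cluster of `C` or inside the bridge until it arrives
    -- at `u`, where it has to stop because `u` is on the reference path.
    have inv : y ∈ between u v ∨ (∃ c ∈ C, Reach (S ∩ D₂) c y) ∨ y = u := by
      clear hyl hyQ
      induction hpath with
      | refl => exact Or.inr (Or.inl ⟨c', hc', Reach.refl c'⟩)
      | @tail x y hx hxy ih =>
        obtain ⟨hs, hoff⟩ := hxy
        rcases bridged_cases hs.1 with hs' | ⟨hS, hxb, -⟩
        · obtain ⟨-, h2, -, h4, -, h6, -⟩ := mem_segment hs'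
          rcases segment_cases huv h2 h4 h6 with h | h | h
          · exact Or.inr (Or.inr h)
          · exact Or.inr (Or.inl ⟨c, hc, h ▸ hcv v hv⟩)
          · exact Or.inl h
        · rcases ih with h | ⟨c₁, hc₁, h⟩ | rfl
          · exact absurd h hxb
          · exact Or.inr (Or.inl ⟨c₁, hc₁, h.trans (Reach.single ⟨hS, hs.2⟩)⟩)
          · exact absurd ⟨hu, huQ⟩ hoff
    rcases inv with h' | h' | h'
    · exact absurd h' (hl y hyl)
    · exact absurd h' (hnotl y hyl hyQ)
    · exact h'

end Reference

/-! ### Reading off the column of the bridge, and the deterministic gluing step -/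

/-- `z` is the column of the vertices at which `C` is attached to the greedy path from `A`. -/
def AttachedColumn (T₁ T₂ : Set (Sym2 (SlabVertex k))) (A B C : Set (SlabVertex k))
    (Q : Set (ℤ × ℤ)) (z : ℤ × ℤ) : Prop :=
  (∃ y, Attached T₁ T₂ A B C Q y) ∧ ∀ y, Attached T₁ T₂ A B C Q y → col y = z

/-- `z` is the column of the bridge in the configuration `S`; the first argument tells which of the
two paths is the reference. -/
def BridgeColumn (i : Bool) (S D₁ D₂ : Set (Sym2 (SlabVertex k))) (A B C E : Set (SlabVertex k))
    (Q : Set (ℤ × ℤ)) (z : ℤ × ℤ) : Prop :=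
  bif i then AttachedColumn (S ∩ D₁) (S ∩ D₂) A B C Q z
  else AttachedColumn (S ∩ D₂) (S ∩ D₁) C E A Q z

theorem AttachedColumn.unique {T₁ T₂ : Set (Sym2 (SlabVertex k))} {A B C : Set (SlabVertex k)}
    {Q : Set (ℤ × ℤ)} {z z' : ℤ × ℤ} (h : AttachedColumn T₁ T₂ A B C Q z)
    (h' : AttachedColumn T₁ T₂ A B C Q z') : z = z' := by
  obtain ⟨⟨y, hy⟩, hz⟩ := h
  exact (hz y hy).symm.trans (h'.2 y hy)

theorem BridgeColumn.unique {i : Bool} {S D₁ D₂ : Set (Sym2 (SlabVertex k))}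
    {A B C E : Set (SlabVertex k)} {Q : Set (ℤ × ℤ)} {z z' : ℤ × ℤ}
    (h : BridgeColumn i S D₁ D₂ A B C E Q z) (h' : BridgeColumn i S D₁ D₂ A B C E Q z') :
    z = z' := by
  cases i
  · exact AttachedColumn.unique (k := k) h h'
  · exact AttachedColumn.unique (k := k) h h'

/-- Every path from `A` to `B` in `D₁` and every path from `C` to `E` in `D₂` visit a common column
in `Q`. -/
def ForcedCrossing (D₁ D₂ : Set (Sym2 (SlabVertex k))) (A B C E : Set (SlabVertex k))
    (Q : Set (ℤ × ℤ)) : Prop :=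
  ∀ l₁ l₂ : List (SlabVertex k), (∃ a ∈ A, l₁.head? = some a) → (∃ b ∈ B, l₁.getLast? = some b) →
    l₁.IsChain (fun x y => s(x, y) ∈ D₁) → (∃ c ∈ C, l₂.head? = some c) →
    (∃ e ∈ E, l₂.getLast? = some e) → l₂.IsChain (fun x y => s(x, y) ∈ D₂) →
    ∃ u ∈ l₁, ∃ v ∈ l₂, col u = col v ∧ col u ∈ Q

/-- The vertical edges over `Q` belong to `D`. -/
def ContainsVertical (D : Set (Sym2 (SlabVertex k))) (Q : Set (ℤ × ℤ)) : Prop :=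
  ∀ x y : SlabVertex k, col x = col y → col x ∈ Q → ht y = ht x + 1 → s(x, y) ∈ D

theorem ContainsVertical.segment_subset {D : Set (Sym2 (SlabVertex k))} {Q : Set (ℤ × ℤ)}
    (h : ContainsVertical D Q) {u v : SlabVertex k} (hu : col u ∈ Q) : segment u v ⊆ D := by
  rintro e ⟨x, y, rfl, hx, hy, hxy, -, -⟩
  exact h x y (hx.trans hy.symm) (hx ▸ hu) hxy

theorem finite_vertices {S D : Set (Sym2 (SlabVertex k))} (hS : S.Finite) :
    {x | ∃ y, s(x, y) ∈ S ∩ D}.Finite := by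
  refine (hS.biUnion (t := fun e => {x | x ∈ e}) ?_).subset ?_
  · intro e _
    induction e with
    | _ a b =>
      refine (Set.toFinite {a, b}).subset ?_
      intro x hx
      simpa using hx
  · rintro x ⟨y, hy, -⟩
    exact Set.mem_biUnion hy (by simp)

/-- Forced crossing provides columns over `Q` visited by both greedy paths. The bridge is put where
their vertical distance is least, so neither path meets its interior and both survive the closing of
edges there. -/
theorem exists_bridge {S D₁ D₂ : Set (Sym2 (SlabVertex k))} {A B C E : Set (SlabVertex k)}
    {Q : Set (ℤ × ℤ)} (hS : S.Finite) (hD₁ : ∀ x y, s(x, y) ∈ D₁ → (slab k).Adj x y)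
    (hD₂ : ∀ x y, s(x, y) ∈ D₂ → (slab k).Adj x y) (hQ₁ : ContainsVertical D₁ Q)
    (hQ₂ : ContainsVertical D₂ Q) (hA : ∀ a ∈ A, col a ∉ Q) (hC : ∀ c ∈ C, col c ∉ Q)
    (hX : ForcedCrossing D₁ D₂ A B C E Q)
    (h₁ : ∃ a ∈ A, ∃ b ∈ B, Reach (S ∩ D₁) a b) (h₂ : ∃ c ∈ C, ∃ e ∈ E, Reach (S ∩ D₂) c e)
    (hY : ∀ w, col w ∈ Q → (∃ a ∈ A, Reach (S ∩ D₁) a w) → ¬∃ c ∈ C, Reach (S ∩ D₂) c w) :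
    ∃ u v i, col v = col u ∧ ht v < ht u ∧ col u ∈ Q ∧
      (((∃ a ∈ A, Reach (S ∩ D₁) a u) ∧ ∃ c ∈ C, Reach (S ∩ D₂) c v) ∨
        ((∃ a ∈ A, Reach (S ∩ D₁) a v) ∧ ∃ c ∈ C, Reach (S ∩ D₂) c u)) ∧
      (∃ a ∈ A, ∃ b ∈ B, Reach (bridged S u v ∩ D₁) a b) ∧
      (∃ c ∈ C, ∃ e ∈ E, Reach (bridged S u v ∩ D₂) c e) ∧
      (∃ w, col w ∈ Q ∧ (∃ a ∈ A, Reach (bridged S u v ∩ D₁) a w) ∧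
        ∃ c ∈ C, Reach (bridged S u v ∩ D₂) c w) ∧
      BridgeColumn i (bridged S u v) D₁ D₂ A B C E Q (col u) := by
  obtain ⟨l₁, hg₁⟩ := GreedyFrom.exists (key := slabKey (k := k)) (finite_vertices hS) h₁
  obtain ⟨l₂, hg₂⟩ := GreedyFrom.exists (key := slabKey (k := k)) (finite_vertices hS) h₂
  obtain ⟨a, ha, -, -, hl₁⟩ := id hg₁
  obtain ⟨c, hc, -, -, hl₂⟩ := id hg₂
  obtain ⟨b, hb, hb'⟩ := hl₁.getLast
  obtain ⟨e, he, he'⟩ := hl₂.getLast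
  have hch₁ := hl₁.isChain
  have hch₂ := hl₂.isChain
  obtain ⟨t₁, rfl⟩ := hl₁.head
  obtain ⟨t₂, rfl⟩ := hl₂.head
  -- As subtraction in `ℕ` is truncated, this sum is the absolute difference of the heights.
  have hmeet : ∃ d : ℕ, ∃ u ∈ a :: t₁, ∃ v ∈ c :: t₂, col u = col v ∧ col u ∈ Q ∧
      (ht u - ht v) + (ht v - ht u) = d := by
    obtain ⟨u, hu, v, hv, huv, huQ⟩ := hX (a :: t₁) (c :: t₂) ⟨a, ha, rfl⟩ ⟨b, hb, hb'⟩
      (hch₁.imp fun _ _ h => h.2) ⟨c, hc, rfl⟩ ⟨e, he, he'⟩ (hch₂.imp fun _ _ h => h.2)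
    exact ⟨_, u, hu, v, hv, huv, huQ, rfl⟩
  classical
  obtain ⟨u, hu, v, hv, huv, huQ, hd⟩ := Nat.find_spec hmeet
  have hmin := fun m => Nat.find_min (m := m) hmeet
  have hau : ∃ a ∈ A, Reach (S ∩ D₁) a u := hg₁.reach u hu
  have hcv : ∃ c ∈ C, Reach (S ∩ D₂) c v := hg₂.reach v hv
  have hne : ht u ≠ ht v := by
    intro h
    obtain rfl := ext_col_ht huv h
    exact hY u huQ hau hcv
  -- The reference is the path that carries the upper end of the bridge, because only steps
  -- downwards are harmless for the greedy choice. The value of `i` records which path this is.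
  rcases lt_or_gt_of_ne hne with hlt | hlt
  · have hl₁' : ∀ t ∈ a :: t₁, t ∉ between v u := by
      rintro t ht' ⟨h1, h2, h3⟩
      refine hmin _ ?_ ⟨t, ht', v, hv, h1, ?_, rfl⟩
      · rw [← hd]
        omega
      · rw [h1, ← huv]
        exact huQ
    have hl₂' : ∀ t ∈ c :: t₂, t ∉ between v u := by
      rintro t ht' ⟨h1, h2, h3⟩
      refine hmin _ ?_ ⟨u, hu, t, ht', huv.trans h1.symm, huQ, rfl⟩
      rw [← hd]
      omega
    have hvQ : col v ∈ Q := huv ▸ huQ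
    obtain ⟨-, r1, r2⟩ := attached_bridged hD₂ (hQ₁.segment_subset hvQ) huv hlt
      hvQ hC hA (fun w hw h h' => hY w hw h' h) hg₂ hl₂' hv ha hch₁ hl₁' hu
    refine ⟨v, u, false, huv, hlt, hvQ, Or.inr ⟨hau, hcv⟩,
      ⟨a, ha, b, hb, reach_bridged_of_chain hch₁ hl₁' (List.mem_of_getLast? hb')⟩,
      ⟨c, hc, e, he, reach_bridged_of_chain hch₂ hl₂' (List.mem_of_getLast? he')⟩,
      ⟨v, hvQ, ⟨a, ha, (reach_bridged_of_chain hch₁ hl₁' hu).trans ?_⟩,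
        c, hc, reach_bridged_of_chain hch₂ hl₂' hv⟩, ⟨v, r1⟩, fun y hy => by rw [r2 y hy]⟩
    exact reach_segment huv hlt.le
      (Set.subset_inter Set.subset_union_right (hQ₁.segment_subset hvQ))
  · have hl₁' : ∀ t ∈ a :: t₁, t ∉ between u v := by
      rintro t ht' ⟨h1, h2, h3⟩
      refine hmin _ ?_ ⟨t, ht', v, hv, h1.trans huv, h1 ▸ huQ, rfl⟩
      rw [← hd]
      omega
    have hl₂' : ∀ t ∈ c :: t₂, t ∉ between u v := by
      rintro t ht' ⟨h1, h2, h3⟩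
      refine hmin _ ?_ ⟨u, hu, t, ht', h1.symm, huQ, rfl⟩
      rw [← hd]
      omega
    obtain ⟨-, r1, r2⟩ := attached_bridged hD₁ (hQ₂.segment_subset huQ) huv.symm hlt
      huQ hA hC hY hg₁ hl₁' hu hc hch₂ hl₂' hv
    refine ⟨u, v, true, huv.symm, hlt, huQ, Or.inl ⟨hau, hcv⟩,
      ⟨a, ha, b, hb, reach_bridged_of_chain hch₁ hl₁' (List.mem_of_getLast? hb')⟩,
      ⟨c, hc, e, he, reach_bridged_of_chain hch₂ hl₂' (List.mem_of_getLast? he')⟩,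
      ⟨u, huQ, ⟨a, ha, reach_bridged_of_chain hch₁ hl₁' hu⟩,
        c, hc, (reach_bridged_of_chain hch₂ hl₂' hv).trans ?_⟩, ⟨u, r1⟩, fun y hy => by rw [r2 y hy]⟩
    exact reach_segment huv.symm hlt.le
      (Set.subset_inter Set.subset_union_right (hQ₂.segment_subset huQ))

/-! ### Percolation on a finite edge set: Harris' inequality and the cost of surgery -/

section Weights

variable {E : Type*}

open Classical in
/-- The probability of the configuration `S` on the finite edge set `Λ`. -/
noncomputable def weight (p : ℝ) (Λ S : Finset E) : ℝ := ∏ e ∈ Λ, if e ∈ S then p else 1 - p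

open Classical in
/-- The configurations on the finite edge set `Λ` that belong to the event `X`. -/
noncomputable def configs (Λ : Finset E) (X : Set E → Prop) : Finset (Finset E) :=
  Λ.powerset.filter fun S : Finset E => X (↑S : Set E)

theorem mem_configs {Λ S : Finset E} {X : Set E → Prop} : S ∈ configs Λ X ↔ S ⊆ Λ ∧ X ↑S := by
  simp [configs]

/-- The probability of the event `X` under Bernoulli percolation on the finite edge set `Λ`. -/
noncomputable def prob (p : ℝ) (Λ : Finset E) (X : Set E → Prop) : ℝ :=
  ∑ S ∈ configs Λ X, weight p Λ S

variable {p : ℝ} {Λ : Finset E}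

theorem weight_nonneg (h0 : 0 ≤ p) (h1 : p ≤ 1) (S : Finset E) : 0 ≤ weight p Λ S :=
  Finset.prod_nonneg fun e _ => by split_ifs <;> linarith

theorem sum_weight (p : ℝ) (Λ : Finset E) : ∑ S ∈ Λ.powerset, weight p Λ S = 1 := by
  classical
  have h := Finset.prod_add (fun _ : E => p) (fun _ => 1 - p) Λ
  simp only [add_sub_cancel, Finset.prod_const_one] at h
  rw [h]
  refine Finset.sum_congr rfl fun S hS => ?_
  rw [weight, Finset.prod_ite]
  congr 1
  · refine Finset.prod_congr ?_ fun _ _ => rfl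
    ext e
    simp only [Finset.mem_filter]
    exact ⟨fun h => h.2, fun h => ⟨Finset.mem_powerset.1 hS h, h⟩⟩
  · refine Finset.prod_congr ?_ fun _ _ => rfl
    ext e
    simp

theorem prob_nonneg (h0 : 0 ≤ p) (h1 : p ≤ 1) (X : Set E → Prop) : 0 ≤ prob p Λ X :=
  Finset.sum_nonneg fun _ _ => weight_nonneg h0 h1 _

theorem prob_mono (h0 : 0 ≤ p) (h1 : p ≤ 1) {X Y : Set E → Prop}
    (h : ∀ S : Finset E, S ⊆ Λ → X ↑S → Y ↑S) : prob p Λ X ≤ prob p Λ Y := by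
  refine Finset.sum_le_sum_of_subset_of_nonneg ?_ fun _ _ _ => weight_nonneg h0 h1 _
  intro S hS
  rw [mem_configs] at hS ⊢
  exact ⟨hS.1, h S hS.1 hS.2⟩

theorem prob_le_add (h0 : 0 ≤ p) (h1 : p ≤ 1) (X Y : Set E → Prop) :
    prob p Λ X ≤ prob p Λ (fun S => X S ∧ ¬Y S) + prob p Λ Y := by
  classical
  rw [prob, prob, prob]
  calc _ ≤ ∑ S ∈ configs Λ (fun S => X S ∧ ¬Y S) ∪ (configs Λ Y),
        weight p Λ S := by
        refine Finset.sum_le_sum_of_subset_of_nonneg ?_ fun _ _ _ => weight_nonneg h0 h1 _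
        intro S hS
        simp only [Finset.mem_union, mem_configs] at hS ⊢
        tauto
    _ ≤ _ := by
        rw [← Finset.sum_union_inter]
        exact le_add_of_nonneg_right (Finset.sum_nonneg fun _ _ => weight_nonneg h0 h1 _)

/-- Harris' inequality for increasing events. -/
theorem prob_mul_le (h0 : 0 ≤ p) (h1 : p ≤ 1) {X Y : Set E → Prop} (hX : Monotone X)
    (hY : Monotone Y) : prob p Λ X * prob p Λ Y ≤ prob p Λ (fun S => X S ∧ Y S) := by
  classical
  have hw : (0 : Finset E → ℝ) ≤ weight p Λ := fun S => weight_nonneg h0 h1 S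
  have key := four_functions_theorem (weight p Λ) (weight p Λ) (weight p Λ) (weight p Λ) hw hw hw hw
    (fun S T => by
      rw [weight, weight, weight, weight, ← Finset.prod_mul_distrib, ← Finset.prod_mul_distrib]
      refine le_of_eq (Finset.prod_congr rfl fun e _ => ?_)
      by_cases hS : e ∈ S <;> by_cases hT : e ∈ T <;> simp [hS, hT, mul_comm])
    (configs Λ X) (configs Λ Y)
  refine key.trans (le_trans (b := 1 * _) (mul_le_mul_of_nonneg_right ?_
    (Finset.sum_nonneg fun _ _ => weight_nonneg h0 h1 _)) ?_)
  · rw [← sum_weight p Λ]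
    refine Finset.sum_le_sum_of_subset_of_nonneg ?_ fun _ _ _ => weight_nonneg h0 h1 _
    intro S hS
    obtain ⟨a, ha, b, hb, rfl⟩ := Finset.mem_infs.1 hS
    rw [mem_configs] at ha
    exact Finset.mem_powerset.2 (Finset.inter_subset_left.trans ha.1)
  · rw [one_mul]
    refine Finset.sum_le_sum_of_subset_of_nonneg ?_ fun _ _ _ => weight_nonneg h0 h1 _
    intro S hS
    obtain ⟨a, ha, b, hb, rfl⟩ := Finset.mem_sups.1 hS
    rw [mem_configs] at ha hb ⊢
    refine ⟨Finset.union_subset ha.1 hb.1, hX ?_ ha.2, hY ?_ hb.2⟩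
    · exact Finset.coe_subset.2 Finset.subset_union_left
    · exact Finset.coe_subset.2 Finset.subset_union_right

/-- Only the factors of edges in `F` can differ; each is at most 1 for `S` and at least `δ` for
`S'`. -/
theorem weight_le_of_agree {δ : ℝ} (hδ : 0 < δ) (hp : δ ≤ p) (hp' : δ ≤ 1 - p) {m : ℕ}
    {F : Set E} (hF : (↑Λ ∩ F).ncard ≤ m) {S S' : Finset E}
    (h : ∀ e ∈ Λ, e ∉ F → (e ∈ S ↔ e ∈ S')) : weight p Λ S ≤ (1 / δ) ^ m * weight p Λ S' := by
  classical
  have hδ1 : 1 ≤ 1 / δ := by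
    rw [le_div_iff₀ hδ]
    linarith
  calc weight p Λ S ≤ ∏ e ∈ Λ, ((if e ∈ F then 1 / δ else 1) * if e ∈ S' then p else 1 - p) := by
        refine Finset.prod_le_prod (fun e _ => by split_ifs <;> linarith) fun e he => ?_
        by_cases heF : e ∈ F
        · rw [if_pos heF]
          have h1 : (if e ∈ S then p else 1 - p) ≤ 1 := by split_ifs <;> linarith
          refine h1.trans ?_
          rw [div_mul_eq_mul_div, one_mul, le_div_iff₀ hδ, one_mul]
          split_ifs <;> linarith
        · simp only [heF, if_false, one_mul, h e he heF, le_refl]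
    _ = (1 / δ) ^ (Λ.filter (· ∈ F)).card * weight p Λ S' := by
        rw [Finset.prod_mul_distrib, ← Finset.prod_filter, Finset.prod_const, weight]
    _ ≤ _ := by
        refine mul_le_mul_of_nonneg_right (pow_le_pow_right₀ hδ1 ?_)
          (weight_nonneg (by linarith) (by linarith) _)
        rw [← Set.ncard_coe_finset]
        convert hF using 2
        ext e
        simp

/-- A map from `X` to `Y` which modifies a configuration only in a bounded set of edges, and for
which this set can be read off the image, does not change probabilities too much. -/
theorem prob_le_of_surgery {Z : Type*} [Nonempty Z] {δ : ℝ} (hδ : 0 < δ) (hp : δ ≤ p) (hp' : δ ≤ 1 - p)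
    {m : ℕ} {F : Z → Set E} (hF : ∀ z, (↑Λ ∩ F z).ncard ≤ m) {X Y : Set E → Prop}
    {R : Bool → Set E → Z → Prop} (hR : ∀ i S z z', R i S z → R i S z' → z = z')
    (h : ∀ S : Finset E, S ⊆ Λ → X ↑S → ∃ S' : Finset E, S' ⊆ Λ ∧ Y ↑S' ∧
      ∃ i z, R i ↑S' z ∧ ∀ e ∈ Λ, e ∉ F z → (e ∈ S ↔ e ∈ S')) :
    prob p Λ X ≤ 2 * (2 / δ) ^ m * prob p Λ Y := by
  classical
  have hw : ∀ S, 0 ≤ weight p Λ S := weight_nonneg (by linarith) (by linarith)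
  choose! φ h1 h2 i z h3 h4 using h
  have hmem : ∀ {S}, S ∈ configs Λ X → S ⊆ Λ ∧ X ↑S := fun hS => by
    rwa [mem_configs] at hS
  -- Given the image and the value of `i`, the relation `R` determines `z`; a preimage is then known
  -- off `F z`, and has at most `2 ^ m` possible traces on it.
  have hfib : ∀ S' : Finset E,
      ((configs Λ X).filter fun S => φ S = S').card ≤ 2 * 2 ^ m := by
    intro S'
    have hone : ∀ j, (((configs Λ X).filter fun S => φ S = S').filter
        fun S => i S = j).card ≤ 2 ^ m := by
      intro j
      rcases Finset.eq_empty_or_nonempty (((configs Λ X).filter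
        fun S => φ S = S').filter fun S => i S = j) with he | ⟨S₀, hS₀⟩
      · rw [he]
        simp
      · have hz : ∀ S ∈ ((configs Λ X).filter fun S => φ S = S').filter
            fun S => i S = j, z S = z S₀ := by
          intro S hS
          rw [Finset.mem_filter, Finset.mem_filter] at hS hS₀
          obtain ⟨⟨ha, hb⟩, hc⟩ := hS
          obtain ⟨⟨ha', hb'⟩, hc'⟩ := hS₀
          have e1 := h3 S (hmem ha).1 (hmem ha).2
          have e2 := h3 S₀ (hmem ha').1 (hmem ha').2
          rw [hb, hc] at e1
          rw [hb', hc'] at e2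
          exact hR _ _ _ _ e1 e2
        have hcard : (Λ.filter (· ∈ F (z S₀))).card ≤ m := by
          rw [← Set.ncard_coe_finset]
          convert hF (z S₀) using 2
          ext e
          simp
        refine le_trans ?_ (pow_le_pow_right₀ (by norm_num) hcard)
        rw [← Finset.card_powerset]
        refine Finset.card_le_card_of_injOn (fun S => S.filter (· ∈ F (z S₀))) ?_ ?_
        · intro S hS
          have hS' := Finset.mem_filter.1 (Finset.mem_filter.1 hS).1
          exact Finset.mem_powerset.2 (Finset.filter_subset_filter _ (hmem hS'.1).1)
        · intro S hS T hT hST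
          have hS' := Finset.mem_filter.1 (Finset.mem_filter.1 hS).1
          have hT' := Finset.mem_filter.1 (Finset.mem_filter.1 hT).1
          have hST' : S.filter (· ∈ F (z S₀)) = T.filter (· ∈ F (z S₀)) := hST
          have a1 := h4 S (hmem hS'.1).1 (hmem hS'.1).2
          have a2 := h4 T (hmem hT'.1).1 (hmem hT'.1).2
          rw [hz S hS, hS'.2] at a1
          rw [hz T hT, hT'.2] at a2
          ext e
          by_cases heF : e ∈ F (z S₀)
          · have := Finset.ext_iff.1 hST' e
            simpa [heF] using this
          · by_cases he : e ∈ Λ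
            · rw [a1 e he heF, a2 e he heF]
            · exact iff_of_false (fun h => he ((hmem hS'.1).1 h)) fun h => he ((hmem hT'.1).1 h)
    have hsplit : ((configs Λ X).filter fun S => φ S = S') ⊆
        (((configs Λ X).filter fun S => φ S = S').filter
          fun S => i S = true) ∪
        (((configs Λ X).filter fun S => φ S = S').filter
          fun S => i S = false) := by
      intro S hS
      rw [Finset.mem_union]
      cases hi : i S
      · exact Or.inr (Finset.mem_filter.2 ⟨hS, hi⟩)
      · exact Or.inl (Finset.mem_filter.2 ⟨hS, hi⟩)
    calc _ ≤ _ := Finset.card_le_card hsplit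
      _ ≤ _ := Finset.card_union_le _ _
      _ ≤ 2 ^ m + 2 ^ m := add_le_add (hone true) (hone false)
      _ = 2 * 2 ^ m := by ring
  calc prob p Λ X ≤ ∑ S ∈ configs Λ X, (1 / δ) ^ m * weight p Λ (φ S) :=
        Finset.sum_le_sum fun S hS => weight_le_of_agree hδ hp hp' (hF _)
          (h4 S (hmem hS).1 (hmem hS).2)
    _ = ∑ S' ∈ configs Λ Y,
          ∑ S ∈ (configs Λ X).filter (fun S => φ S = S'),
            (1 / δ) ^ m * weight p Λ (φ S) := by
        refine (Finset.sum_fiberwise_of_maps_to (fun S hS => ?_) _).symm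
        rw [mem_configs]
        exact ⟨h1 S (hmem hS).1 (hmem hS).2, h2 S (hmem hS).1 (hmem hS).2⟩
    _ ≤ ∑ S' ∈ configs Λ Y, 2 * (2 / δ) ^ m * weight p Λ S' := by
        refine Finset.sum_le_sum fun S' _ => ?_
        calc _ = ∑ S ∈ (configs Λ X).filter (fun S => φ S = S'),
              (1 / δ) ^ m * weight p Λ S' :=
              Finset.sum_congr rfl fun S hS => by rw [(Finset.mem_filter.1 hS).2]
          _ = (((configs Λ X).filter fun S => φ S = S').card : ℝ) *
              ((1 / δ) ^ m * weight p Λ S') := by rw [Finset.sum_const, nsmul_eq_mul]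
          _ ≤ ((2 * 2 ^ m : ℕ) : ℝ) * ((1 / δ) ^ m * weight p Λ S') := by
              refine mul_le_mul_of_nonneg_right (Nat.cast_le.2 (hfib S')) ?_
              exact mul_nonneg (by positivity) (hw _)
          _ = 2 * (2 / δ) ^ m * weight p Λ S' := by
              push_cast
              rw [div_pow, div_pow, one_pow]
              ring
    _ = 2 * (2 / δ) ^ m * prob p Λ Y := by rw [← Finset.mul_sum, prob]

end Weights

/-! ### The gluing inequality -/

section Gluing

/-- The edges at the vertices of a column. -/
def columnEdges (k : ℕ) (z : ℤ × ℤ) : Set (Sym2 (SlabVertex k)) := {e | ∃ x ∈ e, col x = z}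

theorem adj_col {x y : SlabVertex k} (h : (slab k).Adj x y) :
    -1 ≤ y.1 - x.1 ∧ y.1 - x.1 ≤ 1 ∧ -1 ≤ y.2.1 - x.2.1 ∧ y.2.1 - x.2.1 ≤ 1 := by
  have h' : (x.1 - y.1) ^ 2 + (x.2.1 - y.2.1) ^ 2 + ((ht x : ℤ) - (ht y : ℤ)) ^ 2 = 1 := h
  refine ⟨?_, ?_, ?_, ?_⟩ <;>
    nlinarith [sq_nonneg (x.1 - y.1), sq_nonneg (x.2.1 - y.2.1), sq_nonneg ((ht x : ℤ) - (ht y : ℤ))]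

theorem ncard_columnEdges_le {Λ : Finset (Sym2 (SlabVertex k))}
    (hΛ : ∀ x y, s(x, y) ∈ Λ → (slab k).Adj x y) (z : ℤ × ℤ) :
    (↑Λ ∩ columnEdges k z).ncard ≤ 9 * (k + 1) ^ 2 := by
  classical
  -- An edge at the column is given by the heights of its two ends and by the position of the second
  -- column in the `3 × 3` block around `z`; this overcounts.
  let g : (Fin (k + 1) × Fin (k + 1)) × Fin 3 × Fin 3 → Sym2 (SlabVertex k) := fun t =>
    s((z.1, z.2, t.1.1), (z.1 + (t.2.1 : ℕ) - 1, z.2 + (t.2.2 : ℕ) - 1, t.1.2))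
  have hsub : ↑Λ ∩ columnEdges k z ⊆ (↑(Finset.univ.image g) : Set (Sym2 (SlabVertex k))) := by
    rintro e ⟨he, x, hx, rfl⟩
    obtain ⟨y, rfl⟩ := Sym2.mem_iff_exists.1 hx
    obtain ⟨h1, h2, h3, h4⟩ := adj_col (hΛ x y he)
    obtain ⟨x1, x2, x3⟩ := x
    obtain ⟨y1, y2, y3⟩ := y
    simp only at h1 h2 h3 h4
    rw [Finset.coe_image]
    refine ⟨((x3, y3), ⟨(y1 - x1 + 1).toNat, by omega⟩, ⟨(y2 - x2 + 1).toNat, by omega⟩),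
      Finset.mem_coe.2 (Finset.mem_univ _), ?_⟩
    simp only [g, col]
    have e1 : x1 + ((y1 - x1 + 1).toNat : ℤ) - 1 = y1 := by omega
    have e2 : x2 + ((y2 - x2 + 1).toNat : ℤ) - 1 = y2 := by omega
    rw [e1, e2]
  refine (Set.ncard_le_ncard hsub (Finset.finite_toSet _)).trans ?_
  rw [Set.ncard_coe_finset]
  refine Finset.card_image_le.trans (le_of_eq ?_)
  simp only [Finset.card_univ, Fintype.card_prod, Fintype.card_fin]
  ring

/-- The factor by which the modification of a configuration near a column changes probabilities. -/
noncomputable def surgeryCost (k : ℕ) (δ : ℝ) : ℝ := 2 * (2 / δ) ^ (9 * (k + 1) ^ 2)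

theorem surgeryCost_nonneg {δ : ℝ} (hδ : 0 < δ) : 0 ≤ surgeryCost k δ := by
  unfold surgeryCost
  positivity

variable {p δ : ℝ} {Λ : Finset (Sym2 (SlabVertex k))}

/-- Every edge that a bridge changes has an end over the column of `u`, so the surgery bound applies
with the edges of that column as the modified set. -/
theorem prob_le_of_bridge (hδ : 0 < δ) (hp : δ ≤ p) (hp' : δ ≤ 1 - p)
    (hΛ : ∀ x y, s(x, y) ∈ Λ → (slab k).Adj x y) {X Y : Set (Sym2 (SlabVertex k)) → Prop}
    {R : Bool → Set (Sym2 (SlabVertex k)) → ℤ × ℤ → Prop}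
    (hR : ∀ i S z z', R i S z → R i S z' → z = z')
    (h : ∀ S : Set (Sym2 (SlabVertex k)), S ⊆ ↑Λ → X S → ∃ u v i, col v = col u ∧
      segment u v ⊆ ↑Λ ∧ Y (bridged S u v) ∧ R i (bridged S u v) (col u)) :
    prob p Λ X ≤ surgeryCost k δ * prob p Λ Y := by
  classical
  refine prob_le_of_surgery hδ hp hp' (ncard_columnEdges_le hΛ) hR fun S hS hX => ?_
  obtain ⟨u, v, i, huv, hseg, hY, hRi⟩ := h S (Finset.coe_subset.2 hS) hX
  have hcoe : (↑(Λ.filter (· ∈ bridged ↑S u v)) : Set (Sym2 (SlabVertex k))) =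
      bridged ↑S u v := by
    ext e
    rw [Finset.coe_filter, Set.mem_ofPred_eq]
    refine ⟨fun h => h.2, fun h => ⟨?_, h⟩⟩
    rcases h with h | h
    · exact hS h.1
    · exact hseg h
  refine ⟨_, Finset.filter_subset (· ∈ bridged ↑S u v) _, hcoe.symm ▸ hY, i, col u, hcoe.symm ▸ hRi, ?_⟩
  intro e he heF
  rw [Finset.mem_filter]
  have h1 : e ∉ segment u v := by
    rintro ⟨x, y, rfl, hx, -⟩
    exact heF ⟨x, by simp, hx⟩
  have h2 : ¬∃ x ∈ e, x ∈ between u v := by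
    rintro ⟨x, hx, hxb⟩
    exact heF ⟨x, hx, hxb.1⟩
  constructor
  · exact fun h => ⟨he, Or.inl ⟨h, h2⟩⟩
  · rintro ⟨-, h | h⟩
    · exact h.1
    · exact absurd h h1

/-- The gluing inequality. -/
theorem prob_le_of_forcedCrossing (hδ : 0 < δ) (hp : δ ≤ p) (hp' : δ ≤ 1 - p)
    (hΛ : ∀ x y, s(x, y) ∈ Λ → (slab k).Adj x y) {D₁ D₂ : Set (Sym2 (SlabVertex k))}
    {A B C E : Set (SlabVertex k)} {Q : Set (ℤ × ℤ)} (hD₁ : D₁ ⊆ ↑Λ) (hD₂ : D₂ ⊆ ↑Λ)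
    (hQ₁ : ContainsVertical D₁ Q) (hQ₂ : ContainsVertical D₂ Q) (hA : ∀ a ∈ A, col a ∉ Q)
    (hC : ∀ c ∈ C, col c ∉ Q) (hX : ForcedCrossing D₁ D₂ A B C E Q) :
    prob p Λ (fun S => (∃ a ∈ A, ∃ b ∈ B, Reach (S ∩ D₁) a b) ∧
        ∃ c ∈ C, ∃ e ∈ E, Reach (S ∩ D₂) c e) ≤
      (1 + surgeryCost k δ) * prob p Λ (fun S => ∃ w, col w ∈ Q ∧
        (∃ a ∈ A, Reach (S ∩ D₁) a w) ∧ ∃ c ∈ C, Reach (S ∩ D₂) c w) := by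
  have h0 : 0 ≤ p := by linarith
  have h1 : p ≤ 1 := by linarith
  rw [add_mul, one_mul, add_comm]
  refine (prob_le_add h0 h1 _ (fun S => ∃ w, col w ∈ Q ∧
        (∃ a ∈ A, Reach (S ∩ D₁) a w) ∧ ∃ c ∈ C, Reach (S ∩ D₂) c w)).trans
    (add_le_add_left ?_ _)
  refine prob_le_of_bridge hδ hp hp' hΛ (R := fun i S z => BridgeColumn i S D₁ D₂ A B C E Q z)
    (fun _ _ _ _ h h' => h.unique h') ?_
  rintro S hS ⟨⟨hE1, hE2⟩, hnY⟩
  obtain ⟨u, v, i, huv, -, huQ, -, -, -, hY, hR⟩ := exists_bridge (Set.Finite.subset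
    (Finset.finite_toSet Λ) hS) (fun x y h => hΛ x y (hD₁ h)) (fun x y h => hΛ x y (hD₂ h)) hQ₁ hQ₂
    hA hC hX hE1 hE2 (fun w hw h1 h2 => hnY ⟨w, hw, h1, h2⟩)
  exact ⟨u, v, i, huv, (hQ₁.segment_subset huQ).trans hD₁, hY, hR⟩

end Gluing

/-! ### Horizontal and vertical lattice crossings of a rectangle intersect -/

section PlanarCrossing

/-- `b` is `a` or one of its four neighbours in `ℤ²`. -/
def PlaneStep (a b : ℤ × ℤ) : Prop :=
  (b.1 = a.1 ∧ (b.2 = a.2 ∨ b.2 = a.2 + 1 ∨ b.2 = a.2 - 1)) ∨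
    (b.2 = a.2 ∧ (b.1 = a.1 + 1 ∨ b.1 = a.1 - 1))

theorem PlaneStep.symm {a b : ℤ × ℤ} (h : PlaneStep a b) : PlaneStep b a := by
  unfold PlaneStep at *
  omega

/-- The signed number of upward crossings by a path of the line between the rows `y` and `y + 1`,
to the left of `x`. -/
def rowCrossings (x y : ℤ) : List (ℤ × ℤ) → ℤ
  | a :: b :: l => ((if y < b.2 then 1 else 0) - if y < a.2 then 1 else 0) *
      (if a.1 < x then 1 else 0) + rowCrossings x y (b :: l)
  | _ => 0

theorem rowCrossings_eq_zero {x : ℤ} (y : ℤ) {l : List (ℤ × ℤ)} (h : ∀ q ∈ l, x ≤ q.1) :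
    rowCrossings x y l = 0 := by
  induction l with
  | nil => rfl
  | cons a l ih =>
    cases l with
    | nil => rfl
    | cons b l =>
      rw [rowCrossings, ih fun q hq => h q (List.mem_cons_of_mem _ hq),
        if_neg (not_lt.2 (h a List.mem_cons_self))]
      ring

theorem rowCrossings_of_lt {x : ℤ} (y : ℤ) {a b : ℤ × ℤ} {l : List (ℤ × ℤ)}
    (h : ∀ q ∈ a :: l, q.1 < x) (hb : (a :: l).getLast? = some b) :
    rowCrossings x y (a :: l) = (if y < b.2 then 1 else 0) - if y < a.2 then 1 else 0 := by
  induction l generalizing a with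
  | nil =>
    obtain rfl : a = b := by simpa using hb
    rw [rowCrossings, sub_self]
    simp
  | cons c l ih =>
    rw [List.getLast?_cons_cons] at hb
    rw [rowCrossings, ih (fun q hq => h q (List.mem_cons_of_mem _ hq)) hb,
      if_pos (h a List.mem_cons_self)]
    ring

/-- Moving `x` to `x + 1` only brings in steps between `(x, y)` and `(x, y + 1)`, and these use the
point that the path avoids. -/
theorem rowCrossings_add_one {x y : ℤ} {l : List (ℤ × ℤ)} (hl : l.IsChain PlaneStep)
    (h : (x, y) ∉ l) : rowCrossings (x + 1) y l = rowCrossings x y l := by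
  induction l with
  | nil => rfl
  | cons a l ih =>
    cases l with
    | nil => rfl
    | cons b l =>
      rw [List.isChain_cons_cons] at hl
      rw [rowCrossings, rowCrossings, ih hl.2 fun h' => h (List.mem_cons_of_mem _ h')]
      congr 1
      have h1 : ¬(a.1 = x ∧ a.2 = y) := fun h' => h (by simp [← h'.1, ← h'.2])
      have h2 : ¬(b.1 = x ∧ b.2 = y) := fun h' => h (by simp [← h'.1, ← h'.2])
      have h3 := hl.1
      unfold PlaneStep at h3
      split_ifs <;> omega

/-- Conservation of flow on the part of row `y` to the left of `x`: a path can leave it sideways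
only through `(x, y)`, so what enters from below and does not leave above is accounted for by the
two ends of the path. -/
theorem rowCrossings_sub {x y : ℤ} {a b : ℤ × ℤ} {l : List (ℤ × ℤ)}
    (hl : (a :: l).IsChain PlaneStep) (h : (x, y) ∉ a :: l) (hb : (a :: l).getLast? = some b) :
    rowCrossings x (y - 1) (a :: l) - rowCrossings x y (a :: l) =
      (if b.2 = y ∧ b.1 < x then 1 else 0) - if a.2 = y ∧ a.1 < x then 1 else 0 := by
  induction l generalizing a with
  | nil =>
    obtain rfl : a = b := by simpa using hb
    rw [rowCrossings, rowCrossings] <;> simp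
  | cons c l ih =>
    rw [List.getLast?_cons_cons] at hb
    rw [List.isChain_cons_cons] at hl
    have h0 := ih hl.2 (fun h' => h (List.mem_cons_of_mem _ h')) hb
    rw [rowCrossings, rowCrossings]
    have h1 : ¬(a.1 = x ∧ a.2 = y) := fun h' => h (by simp [← h'.1, ← h'.2])
    have h2 : ¬(c.1 = x ∧ c.2 = y) := fun h' => h (by simp [← h'.1, ← h'.2])
    have h3 := hl.1
    unfold PlaneStep at h3
    have h4 : ((if y - 1 < c.2 then (1 : ℤ) else 0) - if y - 1 < a.2 then 1 else 0) *
        (if a.1 < x then 1 else 0) - ((if y < c.2 then (1 : ℤ) else 0) - if y < a.2 then 1 else 0) *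
        (if a.1 < x then 1 else 0) =
        (if c.2 = y ∧ c.1 < x then 1 else 0) - if a.2 = y ∧ a.1 < x then 1 else 0 := by
      split_ifs <;> omega
    linarith

/-- A path from the left side to the right side of a rectangle and a path from the bottom to the top
intersect. -/
theorem exists_mem_of_crossing {x₀ x₁ y₀ y₁ : ℤ} {a a' b b' : ℤ × ℤ} {P Q : List (ℤ × ℤ)}
    (hP : (a :: P).IsChain PlaneStep) (hQ : (b :: Q).IsChain PlaneStep)
    (hP' : ∀ z ∈ a :: P, y₀ ≤ z.2 ∧ z.2 ≤ y₁) (hQ' : ∀ z ∈ b :: Q, x₀ ≤ z.1 ∧ z.1 ≤ x₁)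
    (ha : a.1 = x₀) (ha' : (a :: P).getLast? = some a') (hx : a'.1 = x₁) (hb : b.2 = y₀)
    (hb' : (b :: Q).getLast? = some b') (hy : b'.2 = y₁) : ∃ z ∈ a :: P, z ∈ b :: Q := by
  by_contra! hPQ
  -- The vertical path is prolonged by one step above the rectangle, so that its end lies strictly
  -- above row `y` even for `y = y₁`.
  set t : ℤ × ℤ := (b'.1, y₁ + 1) with ht
  set R := Q ++ [t] with hR
  have hRl : (b :: R).getLast? = some t := by
    rw [hR, ← List.cons_append, List.getLast?_concat]
  have hRc : (b :: R).IsChain PlaneStep := by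
    rw [hR, ← List.cons_append, List.isChain_append]
    refine ⟨hQ, List.isChain_singleton _, fun z hz z' hz' => ?_⟩
    rw [hb', Option.mem_some_iff] at hz
    have h2 : t = z' := by simpa using hz'
    rw [← hz, ← h2]
    exact Or.inl ⟨rfl, Or.inr (Or.inl (by rw [hy]))⟩
  have hRx : ∀ z ∈ b :: R, x₀ ≤ z.1 ∧ z.1 ≤ x₁ := by
    intro z hz
    rw [hR, ← List.cons_append, List.mem_append] at hz
    rcases hz with hz | hz
    · exact hQ' z hz
    · rw [List.mem_singleton.1 hz]
      exact hQ' b' (List.mem_of_getLast? hb')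
  have hPR : ∀ z ∈ a :: P, z ∉ b :: R := by
    intro z hz hz'
    rw [hR, ← List.cons_append, List.mem_append] at hz'
    rcases hz' with hz' | hz'
    · exact hPQ z hz hz'
    · have := (hP' z hz).2
      rw [List.mem_singleton.1 hz'] at this
      simp only [ht] at this
      omega
  have hvert : ∀ x y, y₀ ≤ y - 1 → y ≤ y₁ → (x, y) ∉ b :: R →
      rowCrossings x (y - 1) (b :: R) = rowCrossings x y (b :: R) := by
    intro x y h1 h2 h3
    have := rowCrossings_sub hRc h3 hRl
    rw [if_neg, if_neg] at this
    · linarith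
    · omega
    · simp only [ht]
      omega
  -- The number of crossings to the left of the current point does not change along a path that
  -- avoids the vertical one.
  have hconst : ∀ (P : List (ℤ × ℤ)) (a : ℤ × ℤ), (a :: P).IsChain PlaneStep →
      (∀ z ∈ a :: P, y₀ ≤ z.2 ∧ z.2 ≤ y₁) → (∀ z ∈ a :: P, z ∉ b :: R) →
      (a :: P).getLast? = some a' →
      rowCrossings a.1 a.2 (b :: R) = rowCrossings a'.1 a'.2 (b :: R) := by
    intro P
    induction P with
    | nil =>
      intro a _ _ _ h
      obtain rfl : a = a' := by simpa using h
      rfl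
    | cons c P ih =>
      intro a h1 h2 h3 h4
      rw [List.getLast?_cons_cons] at h4
      rw [List.isChain_cons_cons] at h1
      rw [← ih c h1.2 (fun z hz => h2 z (List.mem_cons_of_mem _ hz))
        (fun z hz => h3 z (List.mem_cons_of_mem _ hz)) h4]
      have ha := h2 a List.mem_cons_self
      have hc := h2 c (by simp)
      have ha' : (a.1, a.2) ∉ b :: R := h3 a List.mem_cons_self
      have hc' : (c.1, c.2) ∉ b :: R := h3 c (by simp)
      rcases h1.1 with ⟨e1, e2 | e2 | e2⟩ | ⟨e1, e2 | e2⟩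
      · rw [e1, e2]
      · rw [← hvert c.1 c.2 (by omega) (by omega) hc', e1, e2, add_sub_cancel_right]
      · rw [← hvert a.1 a.2 (by omega) (by omega) ha', e1, e2]
      · rw [e1, e2, rowCrossings_add_one hRc ha']
      · rw [← rowCrossings_add_one hRc hc', e1, e2, sub_add_cancel]
  have h := hconst P a hP hP' hPR ha'
  have haP := hP' a' (List.mem_of_getLast? ha')
  -- At the left side nothing crosses to the left, which gives 0. At the right side, after passing
  -- to `x₁ + 1`, every crossing counts and the sum telescopes to 1.
  rw [rowCrossings_eq_zero a.2 fun q hq => by rw [ha]; exact (hRx q hq).1,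
    ← rowCrossings_add_one hRc (hPR a' (List.mem_of_getLast? ha')),
    rowCrossings_of_lt a'.2 (fun q hq => by rw [hx]; exact Int.lt_add_one_of_le (hRx q hq).2) hRl,
    if_pos, if_neg] at h
  · omega
  · omega
  · simp only [ht]
    omega

end PlanarCrossing

/-! ### Cells of side `n`, and crossings forced in a common cell -/

section Cells

/-- The index of the cell of side length `n` that contains `z`. -/
def cellOf (n : ℕ) (z : ℤ × ℤ) : ℤ × ℤ := (z.1 / n, z.2 / n)

theorem cellOf_eq_iff {n : ℕ} (hn : 0 < n) {z c : ℤ × ℤ} : cellOf n z = c ↔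
    (c.1 * n ≤ z.1 ∧ z.1 < c.1 * n + n) ∧ c.2 * n ≤ z.2 ∧ z.2 < c.2 * n + n := by
  have hn' : (0 : ℤ) < n := by exact_mod_cast hn
  have key : ∀ a b : ℤ, a / n = b ↔ b * n ≤ a ∧ a < b * n + n := by
    intro a b
    rw [← Int.le_ediv_iff_mul_le hn', ← add_one_mul, ← Int.ediv_lt_iff_lt_mul hn']
    omega
  rw [← key, ← key, cellOf, Prod.ext_iff]

/-- One of the four unit vectors of `ℤ²`. -/
def IsDirection (d : ℤ × ℤ) : Prop := d = (1, 0) ∨ d = (-1, 0) ∨ d = (0, 1) ∨ d = (0, -1)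

instance : DecidablePred IsDirection := fun _ => inferInstanceAs (Decidable (_ ∨ _))

/-- The side of the cell `c` in the direction `d`. -/
def side (n : ℕ) (c d : ℤ × ℤ) : Set (ℤ × ℤ) := {z | cellOf n z = c ∧ cellOf n (z + d) ≠ c}

theorem mem_side_right {n : ℕ} (hn : 0 < n) {z c : ℤ × ℤ} (h : z ∈ side n c (1, 0)) :
    z.1 = c.1 * n + n - 1 := by
  obtain ⟨h1, h2⟩ := h
  rw [Ne, cellOf_eq_iff hn] at h2
  rw [cellOf_eq_iff hn] at h1
  simp only [Prod.fst_add, Prod.snd_add] at h2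
  omega

theorem mem_side_left {n : ℕ} (hn : 0 < n) {z c : ℤ × ℤ} (h : z ∈ side n c (-1, 0)) :
    z.1 = c.1 * n := by
  obtain ⟨h1, h2⟩ := h
  rw [Ne, cellOf_eq_iff hn] at h2
  rw [cellOf_eq_iff hn] at h1
  simp only [Prod.fst_add, Prod.snd_add] at h2
  omega

theorem mem_side_top {n : ℕ} (hn : 0 < n) {z c : ℤ × ℤ} (h : z ∈ side n c (0, 1)) :
    z.2 = c.2 * n + n - 1 := by
  obtain ⟨h1, h2⟩ := h
  rw [Ne, cellOf_eq_iff hn] at h2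
  rw [cellOf_eq_iff hn] at h1
  simp only [Prod.fst_add, Prod.snd_add] at h2
  omega

theorem mem_side_bottom {n : ℕ} (hn : 0 < n) {z c : ℤ × ℤ} (h : z ∈ side n c (0, -1)) :
    z.2 = c.2 * n := by
  obtain ⟨h1, h2⟩ := h
  rw [Ne, cellOf_eq_iff hn] at h2
  rw [cellOf_eq_iff hn] at h1
  simp only [Prod.fst_add, Prod.snd_add] at h2
  omega

theorem exists_mem_of_crossing_list {x₀ x₁ y₀ y₁ : ℤ} {a a' b b' : ℤ × ℤ} {P Q : List (ℤ × ℤ)}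
    (hP : P.IsChain PlaneStep) (hQ : Q.IsChain PlaneStep)
    (hP' : ∀ z ∈ P, y₀ ≤ z.2 ∧ z.2 ≤ y₁) (hQ' : ∀ z ∈ Q, x₀ ≤ z.1 ∧ z.1 ≤ x₁)
    (ha : P.head? = some a) (ha' : P.getLast? = some a')
    (hx : (a.1 = x₀ ∧ a'.1 = x₁) ∨ (a.1 = x₁ ∧ a'.1 = x₀))
    (hb : Q.head? = some b) (hb' : Q.getLast? = some b')
    (hy : (b.2 = y₀ ∧ b'.2 = y₁) ∨ (b.2 = y₁ ∧ b'.2 = y₀)) : ∃ z ∈ P, z ∈ Q := by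
  wlog hxa : a.1 = x₀ ∧ a'.1 = x₁ generalizing P a a'
  · have h := this (P := P.reverse) (a := a') (a' := a)
      (List.isChain_reverse.2 (hP.imp fun _ _ h => h.symm)) (by simpa using hP') (by simpa using ha')
      (by simpa using ha) (by omega) (by omega)
    simpa using h
  wlog hyb : b.2 = y₀ ∧ b'.2 = y₁ generalizing Q b b'
  · have h := this (Q := Q.reverse) (b := b') (b' := b)
      (List.isChain_reverse.2 (hQ.imp fun _ _ h => h.symm)) (by simpa using hQ') (by simpa using hb')
      (by simpa using hb) (by omega) (by omega)
    simpa using h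
  cases P with
  | nil => simp at ha
  | cons p P =>
    cases Q with
    | nil => simp at hb
    | cons q Q =>
      obtain rfl : p = a := by simpa using ha
      obtain rfl : q = b := by simpa using hb
      exact exists_mem_of_crossing hP hQ hP' hQ' hxa.1 ha' hxa.2 hyb.1 hb' hyb.2

theorem orthogonal_cases {d₁ d₂ : ℤ × ℤ} (h₁ : IsDirection d₁) (h₂ : IsDirection d₂)
    (h : d₁.1 * d₂.1 + d₁.2 * d₂.2 = 0) :
    ((d₁ = (1, 0) ∨ d₁ = (-1, 0)) ∧ (d₂ = (0, 1) ∨ d₂ = (0, -1))) ∨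
      (d₂ = (1, 0) ∨ d₂ = (-1, 0)) ∧ (d₁ = (0, 1) ∨ d₁ = (0, -1)) := by
  rcases h₁ with rfl | rfl | rfl | rfl <;> rcases h₂ with rfl | rfl | rfl | rfl <;> simp at h ⊢

/-- Two paths in a cell that cross it in orthogonal directions intersect. -/
theorem exists_mem_of_cell_crossing {n : ℕ} (hn : 0 < n) {c d₁ d₂ : ℤ × ℤ} (h₁ : IsDirection d₁)
    (h₂ : IsDirection d₂) (h₁₂ : d₁.1 * d₂.1 + d₁.2 * d₂.2 = 0) {a a' b b' : ℤ × ℤ}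
    {P Q : List (ℤ × ℤ)} (hP : P.IsChain PlaneStep) (hQ : Q.IsChain PlaneStep)
    (hP' : ∀ z ∈ P, cellOf n z = c) (hQ' : ∀ z ∈ Q, cellOf n z = c)
    (ha : P.head? = some a) (ha' : P.getLast? = some a') (had : a ∈ side n c d₁)
    (had' : a' ∈ side n c (-d₁)) (hb : Q.head? = some b) (hb' : Q.getLast? = some b')
    (hbd : b ∈ side n c d₂) (hbd' : b' ∈ side n c (-d₂)) : ∃ z ∈ P, z ∈ Q := by
  wlog hd : (d₁ = (1, 0) ∨ d₁ = (-1, 0)) ∧ (d₂ = (0, 1) ∨ d₂ = (0, -1))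
    generalizing d₁ d₂ a a' b b' P Q
  · obtain ⟨z, hz, hz'⟩ := this h₂ h₁ (by linarith) hQ hP hQ' hP' hb hb' hbd hbd' ha ha' had had'
      ((orthogonal_cases h₁ h₂ h₁₂).resolve_left hd)
    exact ⟨z, hz', hz⟩
  obtain ⟨e₁, e₂⟩ := hd
  refine exists_mem_of_crossing_list (x₀ := c.1 * n) (x₁ := c.1 * n + n - 1) (y₀ := c.2 * n)
    (y₁ := c.2 * n + n - 1) hP hQ (fun z hz => ?_) (fun z hz => ?_) ha ha' ?_ hb hb' ?_
  · have := (cellOf_eq_iff hn).1 (hP' z hz)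
    omega
  · have := (cellOf_eq_iff hn).1 (hQ' z hz)
    omega
  · rcases e₁ with rfl | rfl
    · exact Or.inr ⟨mem_side_right hn had, mem_side_left hn (by simpa using had')⟩
    · exact Or.inl ⟨mem_side_left hn had, mem_side_right hn (by simpa using had')⟩
  · rcases e₂ with rfl | rfl
    · exact Or.inr ⟨mem_side_top hn hbd, mem_side_bottom hn (by simpa using hbd')⟩
    · exact Or.inl ⟨mem_side_bottom hn hbd, mem_side_top hn (by simpa using hbd')⟩

/-- The vertices over the side of the cell `c` in the direction `d`. -/
def wall (k n : ℕ) (c d : ℤ × ℤ) : Set (SlabVertex k) := {x | col x ∈ side n c d}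

/-- The edges in `D` that enter the cell `c` come from the cell `c₁`. -/
def Enters (D : Set (Sym2 (SlabVertex k))) (n : ℕ) (c c₁ : ℤ × ℤ) : Prop :=
  ∀ x y, s(x, y) ∈ D → cellOf n (col y) = c → cellOf n (col x) = c ∨ cellOf n (col x) = c₁

theorem planeStep_of_adj {x y : SlabVertex k} (h : (slab k).Adj x y) :
    PlaneStep (col x) (col y) := by
  obtain ⟨h1, h2, h3, h4⟩ := adj_col h
  have h' : (x.1 - y.1) ^ 2 + (x.2.1 - y.2.1) ^ 2 + ((ht x : ℤ) - (ht y : ℤ)) ^ 2 = 1 := h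
  have h7 := sq_nonneg ((ht x : ℤ) - (ht y : ℤ))
  have h5 : y.1 - x.1 = -1 ∨ y.1 - x.1 = 0 ∨ y.1 - x.1 = 1 := by omega
  have h6 : y.2.1 - x.2.1 = -1 ∨ y.2.1 - x.2.1 = 0 ∨ y.2.1 - x.2.1 = 1 := by omega
  simp only [PlaneStep, col]
  rcases h5 with h5 | h5 | h5 <;> rcases h6 with h6 | h6 | h6 <;>
    first
    | omega
    | (exfalso; nlinarith)

theorem exists_suffix_of_not {α : Type*} {p : α → Prop} {l : List α} {b : α}
    (hl : l.getLast? = some b) (hb : p b) (h : ∃ a ∈ l, ¬p a) :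
    ∃ l₁ x y l₂, l = l₁ ++ x :: y :: l₂ ∧ ¬p x ∧ ∀ z ∈ y :: l₂, p z := by
  induction l with
  | nil => simp at hl
  | cons a l ih =>
    by_cases hal : ∃ z ∈ l, ¬p z
    · have hl' : l.getLast? = some b := by
        cases l with
        | nil => simp at hal
        | cons c l => rwa [List.getLast?_cons_cons] at hl
      obtain ⟨l₁, x, y, l₂, rfl, h1, h2⟩ := ih hl' hal
      exact ⟨a :: l₁, x, y, l₂, rfl, h1, h2⟩
    · push Not at hal
      have ha : ¬p a := by
        obtain ⟨z, hz, hz'⟩ := h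
        rcases List.mem_cons.1 hz with rfl | hz
        · exact hz'
        · exact absurd (hal z hz) hz'
      cases l with
      | nil =>
        obtain rfl : a = b := by simpa using hl
        exact absurd hb ha
      | cons c l => exact ⟨[], a, c, l, rfl, ha, hal⟩

/-- A path that enters the cell `c` from the cell `c + d` and ends at the opposite side of `c` has a
final part that crosses `c`. -/
theorem exists_cell_crossing {n : ℕ} (hn : 0 < n) {D : Set (Sym2 (SlabVertex k))}
    (hD : ∀ x y, s(x, y) ∈ D → (slab k).Adj x y) {c d : ℤ × ℤ} (hd : IsDirection d)
    (hE : Enters D n c (c + d)) {l : List (SlabVertex k)} {a b : SlabVertex k}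
    (ha : l.head? = some a) (hac : cellOf n (col a) ≠ c) (hb : l.getLast? = some b)
    (hbd : b ∈ wall k n c (-d)) (hl : l.IsChain fun x y => s(x, y) ∈ D) :
    ∃ P : List (ℤ × ℤ), (∀ z ∈ P, ∃ x ∈ l, col x = z) ∧ P.IsChain PlaneStep ∧
      (∀ z ∈ P, cellOf n z = c) ∧ (∃ z, P.head? = some z ∧ z ∈ side n c d) ∧
      P.getLast? = some (col b) := by
  obtain ⟨l₁, x, y, l₂, rfl, hx, hy⟩ := exists_suffix_of_not (p := fun x => cellOf n (col x) = c)
    hb hbd.1 ⟨a, List.mem_of_head? ha, hac⟩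
  rw [List.isChain_append] at hl
  obtain ⟨-, hl, -⟩ := hl
  rw [List.isChain_cons_cons] at hl
  have hyc := hy y List.mem_cons_self
  refine ⟨(y :: l₂).map col, ?_, ?_, ?_, ⟨col y, rfl, hyc, ?_⟩, ?_⟩
  · intro z hz
    obtain ⟨w, hw, rfl⟩ := List.mem_map.1 hz
    exact ⟨w, List.mem_append_right _ (List.mem_cons_of_mem _ hw), rfl⟩
  · rw [List.isChain_map]
    exact hl.2.imp fun u v h => planeStep_of_adj (hD u v h)
  · intro z hz
    obtain ⟨w, hw, rfl⟩ := List.mem_map.1 hz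
    exact hy w hw
  · have hxc : cellOf n (col x) = c + d := (hE x y hl.1 hyc).resolve_left hx
    have hstep := planeStep_of_adj (hD x y hl.1)
    rw [cellOf_eq_iff hn] at hxc hyc
    rw [Ne, cellOf_eq_iff hn]
    unfold PlaneStep at hstep
    have hn' : (0 : ℤ) < n := by exact_mod_cast hn
    rcases hd with rfl | rfl | rfl | rfl <;>
      simp only [Prod.fst_add, Prod.snd_add, add_mul, one_mul, neg_mul, zero_mul] at hxc hyc ⊢ <;>
      omega
  · rw [List.getLast?_map]
    have : (l₁ ++ x :: y :: l₂).getLast? = (y :: l₂).getLast? := by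
      rw [List.getLast?_append]
      simp [List.getLast?_cons]
    rw [← this, hb]
    rfl

/-- The last stay of each path in `c` begins at the side through which it has to enter and ends at
the opposite side. Perpendicular directions then make the two projections intersect. -/
theorem forcedCrossing_of_enters {n : ℕ} (hn : 0 < n) {D₁ D₂ : Set (Sym2 (SlabVertex k))}
    (hD₁ : ∀ x y, s(x, y) ∈ D₁ → (slab k).Adj x y) (hD₂ : ∀ x y, s(x, y) ∈ D₂ → (slab k).Adj x y)
    {c d₁ d₂ : ℤ × ℤ} (h₁ : IsDirection d₁) (h₂ : IsDirection d₂)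
    (h₁₂ : d₁.1 * d₂.1 + d₁.2 * d₂.2 = 0) (hE₁ : Enters D₁ n c (c + d₁))
    (hE₂ : Enters D₂ n c (c + d₂)) {A C : Set (SlabVertex k)} (hA : ∀ a ∈ A, cellOf n (col a) ≠ c)
    (hC : ∀ a ∈ C, cellOf n (col a) ≠ c) :
    ForcedCrossing D₁ D₂ A (wall k n c (-d₁)) C (wall k n c (-d₂)) {z | cellOf n z = c} := by
  rintro l₁ l₂ ⟨a, ha, hal⟩ ⟨b, hb, hbl⟩ hl₁ ⟨a', ha', hal'⟩ ⟨b', hb', hbl'⟩ hl₂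
  obtain ⟨P, hP1, hP2, hP3, ⟨z, hz, hzs⟩, hP5⟩ :=
    exists_cell_crossing hn hD₁ h₁ hE₁ hal (hA a ha) hbl hb hl₁
  obtain ⟨P', hP1', hP2', hP3', ⟨z', hz', hzs'⟩, hP5'⟩ :=
    exists_cell_crossing hn hD₂ h₂ hE₂ hal' (hC a' ha') hbl' hb' hl₂
  obtain ⟨t, ht, ht'⟩ := exists_mem_of_cell_crossing hn h₁ h₂ h₁₂ hP2 hP2' hP3 hP3' hz hP5 hzs hb
    hz' hP5' hzs' hb'
  obtain ⟨u, hu, rfl⟩ := hP1 t ht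
  obtain ⟨v, hv, huv⟩ := hP1' _ ht'
  exact ⟨u, hu, v, hv, huv.symm, hP3 _ ht⟩

end Cells

/-! ### Gluing dominoes along a turning path of cells -/

section CellPaths

/-- The edges of the slab inside the union of two consecutive cells of the list `L`. -/
def cellPathEdges (k n : ℕ) (L : List (ℤ × ℤ)) : Set (Sym2 (SlabVertex k)) :=
  {e | e ∈ (slab k).edgeSet ∧ ∃ c ∈ L.zip L.tail, ∀ x ∈ e,
    cellOf n (col x) = c.1 ∨ cellOf n (col x) = c.2}

/-- In `S ∩ D`, some vertex of `A` is connected to some vertex of `B`. -/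
def Joined (S D : Set (Sym2 (SlabVertex k))) (A B : Set (SlabVertex k)) : Prop :=
  ∃ a ∈ A, ∃ b ∈ B, Reach (S ∩ D) a b

theorem Joined.symm {S D : Set (Sym2 (SlabVertex k))} {A B : Set (SlabVertex k)}
    (h : Joined S D A B) : Joined S D B A := by
  obtain ⟨a, ha, b, hb, h⟩ := h
  exact ⟨b, hb, a, ha, h.symm⟩

theorem monotone_joined (D : Set (Sym2 (SlabVertex k))) (A B : Set (SlabVertex k)) :
    Monotone fun S => Joined S D A B := by
  rintro S T hST ⟨a, ha, b, hb, h⟩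
  exact ⟨a, ha, b, hb, h.mono (Set.inter_subset_inter_left _ hST)⟩

theorem adj_of_mem_cellPathEdges {n : ℕ} {L : List (ℤ × ℤ)} {x y : SlabVertex k}
    (h : s(x, y) ∈ cellPathEdges k n L) : (slab k).Adj x y := h.1

theorem cellPathEdges_cons (n : ℕ) (c : ℤ × ℤ) (L : List (ℤ × ℤ)) :
    cellPathEdges k n L ⊆ cellPathEdges k n (c :: L) := by
  rintro e ⟨he, pr, hpr, h⟩
  refine ⟨he, pr, ?_, h⟩
  cases L with
  | nil => simp at hpr
  | cons b L => exact List.mem_cons_of_mem _ hpr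

theorem cellPathEdges_pair_subset (n : ℕ) (c c' : ℤ × ℤ) (L : List (ℤ × ℤ)) :
    cellPathEdges k n [c, c'] ⊆ cellPathEdges k n (c :: c' :: L) := by
  rintro e ⟨he, pr, hpr, h⟩
  refine ⟨he, pr, ?_, h⟩
  have : pr = (c, c') := by simpa using hpr
  rw [this]
  exact List.mem_cons_self

theorem adj_of_vertical {x y : SlabVertex k} (h : col x = col y) (h' : ht y = ht x + 1) :
    (slab k).Adj x y := by
  have h1 : x.1 = y.1 := congrArg (fun z : ℤ × ℤ => z.1) h
  have h2 : x.2.1 = y.2.1 := congrArg (fun z : ℤ × ℤ => z.2) h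
  show (x.1 - y.1) ^ 2 + (x.2.1 - y.2.1) ^ 2 + ((ht x : ℤ) - (ht y : ℤ)) ^ 2 = 1
  rw [h1, h2, h']
  push_cast
  ring

theorem containsVertical_cellPathEdges {n : ℕ} {L : List (ℤ × ℤ)} {pr : (ℤ × ℤ) × ℤ × ℤ}
    (hpr : pr ∈ L.zip L.tail) {c : ℤ × ℤ} (hc : c = pr.1 ∨ c = pr.2) :
    ContainsVertical (cellPathEdges k n L) {z | cellOf n z = c} := by
  intro x y hxy hx hht
  refine ⟨adj_of_vertical hxy hht, pr, hpr, fun z hz => ?_⟩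
  have hx' : cellOf n (col x) = c := hx
  have hz' : cellOf n (col z) = c := by
    rcases Sym2.mem_iff.1 hz with rfl | rfl
    · exact hx'
    · rwa [← hxy]
  rwa [hz']

theorem enters_cellPathEdges {n : ℕ} {L : List (ℤ × ℤ)} {c c₁ : ℤ × ℤ}
    (h : ∀ pr ∈ L.zip L.tail, (pr.1 = c → pr.2 = c₁) ∧ (pr.2 = c → pr.1 = c₁)) :
    Enters (cellPathEdges k n L) n c c₁ := by
  rintro x y ⟨-, pr, hpr, hxy⟩ hy
  obtain ⟨h1, h2⟩ := h pr hpr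
  have hx := hxy x (by simp)
  rcases hxy y (by simp) with h' | h' <;> rw [hy] at h'
  · rcases hx with hx | hx
    · exact Or.inl (hx.trans h'.symm)
    · exact Or.inr (hx.trans (h1 h'.symm))
  · rcases hx with hx | hx
    · exact Or.inr (hx.trans (h2 h'.symm))
    · exact Or.inl (hx.trans h'.symm)

/-- A list of cells that ends with `c₀`, and enters `c₀` in the direction `d₀`, in which consecutive
cells are neighbours, which makes a turn at every cell, and which visits every cell once. -/
def TurningPath (c₀ d₀ : ℤ × ℤ) : List (ℤ × ℤ) → Prop
  | c' :: c :: c₁ :: L => IsDirection (c' - c) ∧ IsDirection (c₁ - c) ∧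
      (c₁ - c).1 * (c' - c).1 + (c₁ - c).2 * (c' - c).2 = 0 ∧ c₀ ≠ c ∧
      (∀ pr ∈ (c :: c₁ :: L).zip (c₁ :: L), (pr.1 = c → pr.2 = c₁) ∧ (pr.2 = c → pr.1 = c₁)) ∧
      TurningPath c₀ d₀ (c :: c₁ :: L)
  | [c', c] => c = c₀ ∧ c₀ - c' = d₀
  | _ => False

theorem IsDirection.ne_zero {d : ℤ × ℤ} (h : IsDirection d) : d ≠ 0 := by
  rcases h with rfl | rfl | rfl | rfl <;> simp

/-- The path is built from its end `c₀` backwards. Each further domino costs a factor `κ` by Harris'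
inequality, and a division by `1 + surgeryCost k δ` for gluing it in the cell `c` where the path
turns. -/
theorem prob_cellPath {p δ κ : ℝ} {Λ : Finset (Sym2 (SlabVertex k))} {n : ℕ} (hn : 0 < n)
    (hδ : 0 < δ) (hp : δ ≤ p) (hp' : δ ≤ 1 - p) (hκ : 0 ≤ κ)
    (hΛ : ∀ x y, s(x, y) ∈ Λ → (slab k).Adj x y) {c₀ d₀ : ℤ × ℤ} {L : List (ℤ × ℤ)}
    {c c' : ℤ × ℤ} (hL : TurningPath c₀ d₀ (c' :: c :: L))
    (hLΛ : cellPathEdges k n (c' :: c :: L) ⊆ ↑Λ)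
    (hdom : ∀ pr ∈ (c' :: c :: L).zip (c :: L), κ ≤ prob p Λ fun S =>
      Joined S (cellPathEdges k n [pr.1, pr.2]) (wall k n pr.1 (pr.1 - pr.2))
        (wall k n pr.2 (pr.2 - pr.1))) :
    κ * (κ / (1 + surgeryCost k δ)) ^ L.length ≤ prob p Λ fun S =>
      Joined S (cellPathEdges k n (c' :: c :: L)) (wall k n c₀ d₀) (wall k n c' (c' - c)) := by
  have h0 : 0 ≤ p := by linarith
  have h1 : p ≤ 1 := by linarith
  have hcost : 0 < 1 + surgeryCost k δ := by
    have := surgeryCost_nonneg (k := k) hδ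
    linarith
  induction L generalizing c c' with
  | nil =>
    obtain ⟨rfl, rfl⟩ := hL
    rw [List.length_nil, pow_zero, mul_one]
    refine (hdom (c', c) (by simp)).trans (prob_mono h0 h1 fun S _ h => h.symm)
  | cons c₁ L ih =>
    obtain ⟨hd₂, hd₁, hperp, hc₀, hpairs, hL'⟩ := hL
    have ih' := ih hL' ((cellPathEdges_cons n c' _).trans hLΛ)
      fun pr hpr => hdom pr (List.mem_cons_of_mem _ hpr)
    have hdom' := hdom (c', c) List.mem_cons_self
    -- That each cell is visited once ensures that the part already built enters `c` from `c₁` only,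
    -- while the new domino enters it from `c'`.
    have hforced : ForcedCrossing (cellPathEdges k n (c :: c₁ :: L)) (cellPathEdges k n [c', c])
        (wall k n c₀ d₀) (wall k n c (c - c₁)) (wall k n c' (c' - c)) (wall k n c (c - c'))
        {z | cellOf n z = c} := by
      rw [← neg_sub c₁ c, ← neg_sub c' c]
      refine forcedCrossing_of_enters hn (fun _ _ => adj_of_mem_cellPathEdges)
        (fun _ _ => adj_of_mem_cellPathEdges) hd₁ hd₂ hperp ?_ ?_ ?_ ?_
      · rw [add_sub_cancel]
        exact enters_cellPathEdges hpairs
      · rw [add_sub_cancel]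
        refine enters_cellPathEdges fun pr hpr => ?_
        obtain rfl : pr = (c', c) := by simpa using hpr
        exact ⟨fun h => Eq.symm h, fun _ => rfl⟩
      · intro a ha h
        exact hc₀ (ha.1.symm.trans h)
      · intro a ha h
        exact hd₂.ne_zero (sub_eq_zero.2 (ha.1.symm.trans h))
    have hglue := prob_le_of_forcedCrossing hδ hp hp' hΛ ((cellPathEdges_cons n c' _).trans hLΛ)
      ((cellPathEdges_pair_subset n c' c _).trans hLΛ)
      (containsVertical_cellPathEdges (pr := (c, c₁)) (by simp) (Or.inl rfl))
      (containsVertical_cellPathEdges (pr := (c', c)) (by simp) (Or.inr rfl))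
      (fun a ha h => hc₀ (ha.1.symm.trans h))
      (fun a ha h => hd₂.ne_zero (sub_eq_zero.2 (ha.1.symm.trans h))) hforced
    have hmono : prob p Λ (fun S => ∃ w, col w ∈ {z | cellOf n z = c} ∧
        (∃ a ∈ wall k n c₀ d₀, Reach (S ∩ cellPathEdges k n (c :: c₁ :: L)) a w) ∧
          ∃ a ∈ wall k n c' (c' - c), Reach (S ∩ cellPathEdges k n [c', c]) a w) ≤
        prob p Λ fun S => Joined S (cellPathEdges k n (c' :: c :: c₁ :: L)) (wall k n c₀ d₀)
          (wall k n c' (c' - c)) := by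
      refine prob_mono h0 h1 ?_
      rintro S - ⟨w, -, ⟨a, ha, haw⟩, b, hb, hbw⟩
      exact ⟨a, ha, b, hb,
        (haw.mono (Set.inter_subset_inter_right _ (cellPathEdges_cons n c' _))).trans
          (hbw.mono (Set.inter_subset_inter_right _ (cellPathEdges_pair_subset n c' c _))).symm⟩
    have hfkg := prob_mul_le (Λ := Λ) h0 h1
      (monotone_joined (cellPathEdges k n (c :: c₁ :: L)) (wall k n c₀ d₀) (wall k n c (c - c₁)))
      (monotone_joined (cellPathEdges k n [c', c]) (wall k n c' (c' - c)) (wall k n c (c - c')))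
    have hall := (mul_le_mul ih' hdom' hκ (prob_nonneg h0 h1 _)).trans (hfkg.trans
      (hglue.trans (mul_le_mul_of_nonneg_left hmono hcost.le)))
    rw [List.length_cons, pow_succ, ← mul_assoc, ← mul_div_assoc, div_le_iff₀ hcost]
    linarith

end CellPaths

/-! ### Closing two connections that start at a common joint -/

section Closing

/-- `m` and `m'` are connected by a path in `D₁` from `m` to a vertex over `Q`, followed by a path in
`D₂` to `m'`. -/
def Linked (S D₁ D₂ : Set (Sym2 (SlabVertex k))) (Q : Set (ℤ × ℤ)) (m m' : SlabVertex k) : Prop :=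
  ∃ q, col q ∈ Q ∧ Reach (S ∩ D₁) m q ∧ Reach (S ∩ D₂) m' q

/-- Two vertices over `M` are linked in both directions. -/
def DoublyLinked (S D₁ D₂ : Set (Sym2 (SlabVertex k))) (Q M : Set (ℤ × ℤ)) : Prop :=
  ∃ m m', col m ∈ M ∧ col m' ∈ M ∧ Linked S D₁ D₂ Q m m' ∧ Linked S D₁ D₂ Q m' m

/-- If a vertex `t` over `M` is linked to itself once a bridge between `e₁` and `e₂` is added, where
`s` is connected to `e₁` in `D₁` and to `e₂` in `D₂`, then `t` and an end of the bridge are connected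
in the original configuration only if some vertices are doubly linked there. -/
theorem doublyLinked_of_bridged {S D₁ D₂ : Set (Sym2 (SlabVertex k))} {Q M : Set (ℤ × ℤ)}
    {u v s t e₁ e₂ : SlabVertex k} (huv : col v = col u) (huQ : col u ∈ Q)
    (he : (e₁ = u ∧ e₂ = v) ∨ (e₁ = v ∧ e₂ = u)) (h₁ : Reach (S ∩ D₁) s e₁)
    (h₂ : Reach (S ∩ D₂) s e₂) (hs : col s ∈ M) (ht : col t ∈ M) (htu : t ∉ between u v)
    (hlink : Linked (bridged S u v) D₁ D₂ Q t t)
    (h : Reach (S ∩ D₁) t e₂ ∨ Reach (S ∩ D₂) t e₁) : DoublyLinked S D₁ D₂ Q M := by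
  have hcases : ∀ D x y, Reach (bridged S u v ∩ D) x y → x ∉ between u v →
      (Reach (S ∩ D) x y ∧ y ∉ between u v) ∨ Reach (S ∩ D) x e₁ ∨ Reach (S ∩ D) x e₂ := by
    intro D x y hxy hx
    have := reach_bridged_cases huv hxy hx
    rcases he with ⟨rfl, rfl⟩ | ⟨rfl, rfl⟩
    · exact this
    · rwa [or_comm (a := Reach _ _ _)]
  have he₁ : col e₁ ∈ Q := by
    rcases he with ⟨rfl, rfl⟩ | ⟨rfl, rfl⟩
    · exact huQ
    · rwa [huv]
  have he₂ : col e₂ ∈ Q := by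
    rcases he with ⟨rfl, rfl⟩ | ⟨rfl, rfl⟩
    · rwa [huv]
    · exact huQ
  obtain ⟨q, hq, hq₁, hq₂⟩ := hlink
  have hself : ∀ w, Linked S D₁ D₂ Q w w → col w ∈ M → DoublyLinked S D₁ D₂ Q M :=
    fun w hw hwM => ⟨w, w, hwM, hwM, hw, hw⟩
  rcases h with h | h
  · have hts : Linked S D₁ D₂ Q t s := ⟨e₂, he₂, h, h₂⟩
    suffices hst : Linked S D₁ D₂ Q s t ∨ Linked S D₁ D₂ Q t t by
      rcases hst with hst | htt
      · exact ⟨s, t, hs, ht, hst, hts⟩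
      · exact hself t htt ht
    rcases hcases D₂ t q hq₂ htu with ⟨hq₂, hqb⟩ | h' | h'
    · rcases hcases D₁ q t hq₁.symm hqb with ⟨h', -⟩ | h' | h'
      · exact Or.inr ⟨q, hq, h'.symm, hq₂⟩
      · exact Or.inl ⟨q, hq, h₁.trans h'.symm, hq₂⟩
      · exact Or.inr ⟨q, hq, h.trans h'.symm, hq₂⟩
    · exact Or.inl ⟨e₁, he₁, h₁, h'⟩
    · exact Or.inr ⟨e₂, he₂, h, h'⟩
  · have hst : Linked S D₁ D₂ Q s t := ⟨e₁, he₁, h₁, h⟩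
    suffices hts : Linked S D₁ D₂ Q t s ∨ Linked S D₁ D₂ Q t t by
      rcases hts with hts | htt
      · exact ⟨s, t, hs, ht, hst, hts⟩
      · exact hself t htt ht
    rcases hcases D₁ t q hq₁ htu with ⟨hq₁, hqb⟩ | h' | h'
    · rcases hcases D₂ q t hq₂.symm hqb with ⟨h', -⟩ | h' | h'
      · exact Or.inr ⟨q, hq, hq₁, h'.symm⟩
      · exact Or.inr ⟨q, hq, hq₁, h.trans h'.symm⟩
      · exact Or.inl ⟨q, hq, hq₁, h₂.trans h'.symm⟩
    · exact Or.inr ⟨e₁, he₁, h', h⟩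
    · exact Or.inl ⟨e₂, he₂, h', h₂⟩

/-- `m` lies over `M` and is connected to `B` in `D₁` and to `E` in `D₂`. -/
def IsJoint (S D₁ D₂ : Set (Sym2 (SlabVertex k))) (M : Set (ℤ × ℤ)) (B E : Set (SlabVertex k))
    (m : SlabVertex k) : Prop :=
  col m ∈ M ∧ (∃ b ∈ B, Reach (S ∩ D₁) m b) ∧ ∃ e ∈ E, Reach (S ∩ D₂) m e

/-- `z` is the column of the bridge, when it joins the connections that start at the first joint which
is linked to itself. -/
def ClosingColumn (D₁ D₂ : Set (Sym2 (SlabVertex k))) (Q M : Set (ℤ × ℤ))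
    (B E : Set (SlabVertex k)) (i : Bool) (S : Set (Sym2 (SlabVertex k))) (z : ℤ × ℤ) : Prop :=
  ∃ s, IsJoint S D₁ D₂ M B E s ∧ Linked S D₁ D₂ Q s s ∧
    (∀ t, IsJoint S D₁ D₂ M B E t → Linked S D₁ D₂ Q t t → slabKey s ≤ slabKey t) ∧
    BridgeColumn i S D₁ D₂ {s} B {s} E Q z

theorem ClosingColumn.unique {D₁ D₂ : Set (Sym2 (SlabVertex k))} {Q M : Set (ℤ × ℤ)}
    {B E : Set (SlabVertex k)} {i : Bool} {S : Set (Sym2 (SlabVertex k))} {z z' : ℤ × ℤ}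
    (h : ClosingColumn D₁ D₂ Q M B E i S z) (h' : ClosingColumn D₁ D₂ Q M B E i S z') : z = z' := by
  obtain ⟨s, h1, h2, h3, h4⟩ := h
  obtain ⟨s', h1', h2', h3', h4'⟩ := h'
  obtain rfl := slabKey_injective (le_antisymm (h3 s' h1' h2') (h3' s h1 h2))
  exact h4.unique h4'

/-- The connections glued are those of the joint `s` of least key. Surgery makes `s` linked to
itself, and the point is that no smaller such joint appears. A new joint `t` would have to reach the
bridge at the end belonging to the other connection of `s`, and then `s` and `t` would show the
original configuration to be doubly linked. This is why the target event allows two vertices instead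
of one. -/
theorem prob_joint_le {p δ : ℝ} {Λ : Finset (Sym2 (SlabVertex k))} (hδ : 0 < δ) (hp : δ ≤ p)
    (hp' : δ ≤ 1 - p) (hΛ : ∀ x y, s(x, y) ∈ Λ → (slab k).Adj x y)
    {D₁ D₂ : Set (Sym2 (SlabVertex k))} {Q M : Set (ℤ × ℤ)} {B E : Set (SlabVertex k)}
    (hD₁ : D₁ ⊆ ↑Λ) (hD₂ : D₂ ⊆ ↑Λ) (hQ₁ : ContainsVertical D₁ Q) (hQ₂ : ContainsVertical D₂ Q)
    (hQM : ∀ z ∈ M, z ∉ Q)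
    (hX : ∀ s, col s ∈ M → ForcedCrossing D₁ D₂ {s} B {s} E Q) :
    prob p Λ (fun S => ∃ m, IsJoint S D₁ D₂ M B E m) ≤
      (1 + surgeryCost k δ) * prob p Λ fun S => DoublyLinked S D₁ D₂ Q M := by
  rw [add_mul, one_mul, add_comm]
  refine (prob_le_add (by linarith) (by linarith) _ fun S => DoublyLinked S D₁ D₂ Q M).trans
    (add_le_add_left ?_ _)
  refine prob_le_of_bridge hδ hp hp' hΛ (R := ClosingColumn D₁ D₂ Q M B E)
    (fun _ _ _ _ h h' => h.unique h') ?_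
  rintro S hS ⟨⟨m, hm⟩, hnY⟩
  obtain ⟨-, ⟨s, hsj, rfl⟩, hmin⟩ := WellFounded.has_min (wellFounded_lt (α := ℕ ×ₗ ℕ))
    (slabKey '' {m | IsJoint S D₁ D₂ M B E m}) ⟨_, m, hm, rfl⟩
  obtain ⟨hsM, hsB, hsE⟩ := id hsj
  obtain ⟨u, v, i, huv, hlt, huQ, hends, hE1, hE2, hY, hR⟩ := exists_bridge (A := {s}) (C := {s})
    (B := B) (E := E) (Set.Finite.subset (Finset.finite_toSet Λ) hS) (fun x y h => hΛ x y (hD₁ h))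
    (fun x y h => hΛ x y (hD₂ h)) hQ₁ hQ₂
    (by rintro _ rfl; exact hQM _ hsM) (by rintro _ rfl; exact hQM _ hsM) (hX s hsM)
    (by simpa using hsB) (by simpa using hsE)
    (by
      rintro w hw ⟨_, rfl, h1⟩ ⟨_, rfl, h2⟩
      exact hnY ⟨_, _, hsM, hsM, ⟨w, hw, h1, h2⟩, ⟨w, hw, h1, h2⟩⟩)
  have hsl : Linked (bridged S u v) D₁ D₂ Q s s := by
    obtain ⟨w, hw, ⟨_, rfl, h1⟩, _, rfl, h2⟩ := hY
    exact ⟨w, hw, h1, h2⟩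
  refine ⟨u, v, i, huv, (hQ₁.segment_subset huQ).trans hD₁, ⟨s, s, hsM, hsM, hsl, hsl⟩, s,
    ⟨hsM, by simpa using hE1, by simpa using hE2⟩, hsl, ?_, hR⟩
  intro t ⟨htM, ⟨b, hb, htb⟩, e, he, hte⟩ htl
  by_contra hts
  have htj : ¬IsJoint S D₁ D₂ M B E t := fun h => hmin _ ⟨t, h, rfl⟩ (not_le.1 hts)
  have htu : t ∉ between u v := fun h => hQM _ htM (h.1 ▸ huQ)
  obtain ⟨e₁, e₂, hee, h1, h2⟩ : ∃ e₁ e₂, ((e₁ = u ∧ e₂ = v) ∨ (e₁ = v ∧ e₂ = u)) ∧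
      Reach (S ∩ D₁) s e₁ ∧ Reach (S ∩ D₂) s e₂ := by
    simp only [Set.mem_singleton_iff, exists_eq_left] at hends
    rcases hends with h | h
    · exact ⟨u, v, Or.inl ⟨rfl, rfl⟩, h⟩
    · exact ⟨v, u, Or.inr ⟨rfl, rfl⟩, h⟩
  refine hnY (doublyLinked_of_bridged huv huQ hee h1 h2 hsM htM htu htl ?_)
  -- If `t` meets the bridge only at the matching ends, it reaches `B` and `E` through `s` without
  -- the bridge, hence was already a joint, against the choice of `s`.
  by_contra! hne
  refine htj ⟨htM, ?_, ?_⟩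
  · obtain ⟨b', hb', hsb'⟩ := hsB
    rcases reach_bridged_cases huv htb htu with ⟨h, -⟩ | h
    · exact ⟨b, hb, h⟩
    · have : Reach (S ∩ D₁) t e₁ := by
        rcases hee with ⟨rfl, rfl⟩ | ⟨rfl, rfl⟩
        · exact h.resolve_right hne.1
        · exact h.resolve_left hne.1
      exact ⟨b', hb', this.trans (h1.symm.trans hsb')⟩
  · obtain ⟨b', hb', hsb'⟩ := hsE
    rcases reach_bridged_cases huv hte htu with ⟨h, -⟩ | h
    · exact ⟨e, he, h⟩
    · have : Reach (S ∩ D₂) t e₂ := by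
        rcases hee with ⟨rfl, rfl⟩ | ⟨rfl, rfl⟩
        · exact h.resolve_left hne.2
        · exact h.resolve_right hne.2
      exact ⟨b', hb', this.trans (h2.symm.trans hsb')⟩

end Closing

/-! ### Extraction of a simple cycle with nonzero sum from a closed walk -/

section CycleExtraction

variable {V : Type*} {G : SimpleGraph V}

/-- The sum of `f` along a walk. -/
def walkSum (f : V → V → ℝ) {u v : V} (p : G.Walk u v) : ℝ :=
  (p.darts.map fun d => f d.fst d.snd).sum

@[simp] theorem walkSum_nil (f : V → V → ℝ) (u : V) :
    walkSum f (SimpleGraph.Walk.nil : G.Walk u u) = 0 := rfl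

@[simp] theorem walkSum_cons (f : V → V → ℝ) {u v w : V} (h : G.Adj u v) (p : G.Walk v w) :
    walkSum f (SimpleGraph.Walk.cons h p) = f u v + walkSum f p := by
  simp [walkSum]

theorem walkSum_append (f : V → V → ℝ) {u v w : V} (p : G.Walk u v) (q : G.Walk v w) :
    walkSum f (p.append q) = walkSum f p + walkSum f q := by
  simp [walkSum]

/-- A path that contains the edge between its own ends consists of that edge. So an erased loop that
is not a cycle runs back and forth along one edge, and has sum zero by antisymmetry. -/
theorem walkSum_eq_of_mem_edges (f : V → V → ℝ) {u v : V} {p : G.Walk v u} (hp : p.IsPath)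
    (h : s(u, v) ∈ p.edges) : walkSum f p = f v u := by
  cases p with
  | nil => simp at h
  | @cons _ w _ h' r =>
    rw [SimpleGraph.Walk.cons_isPath_iff] at hp
    rw [SimpleGraph.Walk.edges_cons, List.mem_cons] at h
    rcases h with h | h
    · rcases Sym2.eq_iff.1 h with ⟨rfl, rfl⟩ | ⟨rfl, -⟩
      · exact absurd h' (G.irrefl)
      · rw [SimpleGraph.Walk.isPath_iff_nil, ← SimpleGraph.Walk.eq_nil_iff_nil] at hp
        rw [hp.1]
        simp
    · exact absurd (SimpleGraph.Walk.snd_mem_support_of_mem_edges r h) hp.2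

/-- A walk along which the sum of an antisymmetric function differs from that along a path contains a
cycle on which the sum is not zero. -/
theorem exists_isCycle_or_isPath {f : V → V → ℝ} {R : Set V}
    (hf : ∀ a ∈ R, ∀ b ∈ R, G.Adj a b → f b a = -f a b) {u v : V} (p : G.Walk u v)
    (hp : ∀ x ∈ p.support, x ∈ R) :
    (∃ (w : V) (c : G.Walk w w), c.IsCycle ∧ (∀ x ∈ c.support, x ∈ R) ∧ walkSum f c ≠ 0) ∨
      ∃ p' : G.Walk u v, p'.IsPath ∧ (∀ x ∈ p'.support, x ∈ R) ∧ walkSum f p' = walkSum f p := by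
  classical
  induction p with
  | nil => exact Or.inr ⟨SimpleGraph.Walk.nil, SimpleGraph.Walk.IsPath.nil, hp, rfl⟩
  | @cons a b c h p ih =>
    rw [SimpleGraph.Walk.support_cons, List.forall_mem_cons] at hp
    rcases ih hp.2 with hc | ⟨p', hp', hR, hsum⟩
    · exact Or.inl hc
    · by_cases ha : a ∈ p'.support
      · have hspec := congrArg (walkSum f) (p'.take_spec ha)
        rw [walkSum_append] at hspec
        by_cases h0 : walkSum f (SimpleGraph.Walk.cons h (p'.takeUntil a ha)) = 0
        · refine Or.inr ⟨p'.dropUntil a ha, hp'.dropUntil ha, fun x hx =>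
            hR x (p'.support_dropUntil_subset_support ha hx), ?_⟩
          rw [walkSum_cons] at h0 ⊢
          linarith
        · refine Or.inl ⟨a, SimpleGraph.Walk.cons h (p'.takeUntil a ha), ?_, ?_, h0⟩
          · rw [SimpleGraph.Walk.cons_isCycle_iff]
            refine ⟨hp'.takeUntil ha, fun he => h0 ?_⟩
            rw [walkSum_cons, walkSum_eq_of_mem_edges f (hp'.takeUntil ha) he,
              hf a hp.1 b (hp.2 b p.start_mem_support) h]
            ring
          · rw [SimpleGraph.Walk.support_cons, List.forall_mem_cons]
            exact ⟨hp.1, fun x hx => hR x (p'.support_takeUntil_subset_support ha hx)⟩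
      · refine Or.inr ⟨SimpleGraph.Walk.cons h p', hp'.cons ha, ?_, ?_⟩
        · rw [SimpleGraph.Walk.support_cons, List.forall_mem_cons]
          exact ⟨hp.1, hR⟩
        · rw [walkSum_cons, walkSum_cons, hsum]

theorem exists_isCycle_of_walkSum_ne_zero {f : V → V → ℝ} {R : Set V}
    (hf : ∀ a ∈ R, ∀ b ∈ R, G.Adj a b → f b a = -f a b) {u : V} (p : G.Walk u u)
    (hp : ∀ x ∈ p.support, x ∈ R) (h : walkSum f p ≠ 0) :
    ∃ (w : V) (c : G.Walk w w), c.IsCycle ∧ (∀ x ∈ c.support, x ∈ R) ∧ walkSum f c ≠ 0 := by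
  refine (exists_isCycle_or_isPath hf p hp).resolve_right ?_
  rintro ⟨p', hp', -, hsum⟩
  rw [SimpleGraph.Walk.isPath_iff_nil, ← SimpleGraph.Walk.eq_nil_iff_nil] at hp'
  rw [hp'] at hsum
  exact h hsum.symm

/-- Where `f` is the increment of a potential `θ`, its sum depends only on the ends of the walk.
This is used with a branch of the angle on each arc. -/
theorem exists_walk_of_reach {T : Set (Sym2 V)} {R : Set V} {f : V → V → ℝ} {θ : V → ℝ}
    (hT : ∀ a b, s(a, b) ∈ T → G.Adj a b ∧ a ∈ R ∧ b ∈ R ∧ f a b = θ b - θ a) {x y : V}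
    (hx : x ∈ R) (h : Reach T x y) :
    ∃ p : G.Walk x y, (∀ z ∈ p.support, z ∈ R) ∧ walkSum f p = θ y - θ x := by
  induction h with
  | refl => exact ⟨SimpleGraph.Walk.nil, by simpa using hx, by simp⟩
  | @tail y z _ hyz ih =>
    obtain ⟨p, hp, hsum⟩ := ih
    obtain ⟨hadj, hy, hz, hf⟩ := hT y z hyz
    refine ⟨p.append (SimpleGraph.Walk.cons hadj SimpleGraph.Walk.nil), ?_, ?_⟩
    · intro w hw
      rw [SimpleGraph.Walk.mem_support_append_iff] at hw
      rcases hw with hw | hw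
      · exact hp w hw
      · simp only [SimpleGraph.Walk.support_cons, SimpleGraph.Walk.support_nil, List.mem_cons,
          List.not_mem_nil, or_false] at hw
        rcases hw with rfl | rfl
        · exact hy
        · exact hz
    · rw [walkSum_append, walkSum_cons, walkSum_nil, hsum, hf]
      ring

end CycleExtraction

/-! ### Angle increments as differences of a branch of the argument -/

section Angles

/-- The two sides agree modulo `2π`. The left one is less than `π/2` in absolute value and the right
one at most `π`, so they cannot differ by a nonzero multiple. -/
theorem arg_div_eq_sub {a b : ℂ} (ha : a ≠ 0) (hb : b ≠ 0) (hab : 0 < (b / a).re)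
    (h : (0 ≤ a.re ∧ 0 ≤ b.re) ∨ (0 ≤ a.im ∧ 0 ≤ b.im) ∨ (a.im < 0 ∧ b.im < 0)) :
    Complex.arg (b / a) = Complex.arg b - Complex.arg a := by
  have h1 := Complex.arg_div_coe_angle hb ha
  rw [← Real.Angle.coe_sub, Real.Angle.angle_eq_iff_two_pi_dvd_sub] at h1
  obtain ⟨m, hm⟩ := h1
  have h2 := abs_lt.1 (Complex.abs_arg_lt_pi_div_two_iff.2 (Or.inl hab))
  have hpi := Real.pi_pos
  have h3 : |Complex.arg b - Complex.arg a| ≤ Real.pi := by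
    rw [abs_le]
    rcases h with ⟨h, h'⟩ | ⟨h, h'⟩ | ⟨h, h'⟩
    · have e1 := abs_le.1 (Complex.abs_arg_le_pi_div_two_iff.2 h)
      have e2 := abs_le.1 (Complex.abs_arg_le_pi_div_two_iff.2 h')
      constructor <;> linarith
    · have e1 := Complex.arg_nonneg_iff.2 h
      have e2 := Complex.arg_nonneg_iff.2 h'
      have e3 := Complex.arg_le_pi a
      have e4 := Complex.arg_le_pi b
      constructor <;> linarith
    · have e1 := Complex.arg_neg_iff.2 h
      have e2 := Complex.arg_neg_iff.2 h'
      have e3 := Complex.neg_pi_lt_arg a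
      have e4 := Complex.neg_pi_lt_arg b
      constructor <;> linarith
  rw [abs_le] at h3
  have h4 : (m : ℝ) < 1 := by
    by_contra! h5
    nlinarith
  have h5 : (-1 : ℝ) < m := by
    by_contra! h5
    nlinarith
  have h6 : m = 0 := by
    have h7 : m < 1 := by exact_mod_cast h4
    have h8 : -1 < m := by exact_mod_cast h5
    omega
  rw [h6] at hm
  simp only [Int.cast_zero, mul_zero] at hm
  linarith

/-- The increment of the angle in a step of the projection to the plane. -/
noncomputable def angleStep (x y : SlabVertex k) : ℝ := Complex.arg (planeProj y / planeProj x)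

/-- A step of length at most 1 from a point at distance at least 2 from the origin turns by less
than a right angle. -/
theorem re_div_pos {x y : SlabVertex k} (h : PlaneStep (col x) (col y))
    (hx : 2 ≤ |x.1| ∨ 2 ≤ |x.2.1|) : 0 < (planeProj y / planeProj x).re := by
  have hint : 0 < y.1 * x.1 + y.2.1 * x.2.1 := by
    have hsq : 4 ≤ x.1 ^ 2 + x.2.1 ^ 2 := by
      rcases hx with hx | hx
      · nlinarith [sq_abs x.1, sq_nonneg x.2.1]
      · nlinarith [sq_abs x.2.1, sq_nonneg x.1]
    simp only [PlaneStep, col] at h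
    rcases h with ⟨e1, e2 | e2 | e2⟩ | ⟨e1, e2 | e2⟩ <;> rw [e1, e2] <;>
      nlinarith [sq_nonneg (x.1 - 1), sq_nonneg (x.1 + 1), sq_nonneg (x.2.1 - 1),
        sq_nonneg (x.2.1 + 1), sq_nonneg x.1, sq_nonneg x.2.1]
  have hreal : (0 : ℝ) < y.1 * x.1 + y.2.1 * x.2.1 := by exact_mod_cast hint
  rw [Complex.div_re, ← add_div]
  refine div_pos hreal (Complex.normSq_pos.2 fun h0 => ?_)
  have e1 : (x.1 : ℝ) = 0 := congrArg Complex.re h0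
  have e2 : (x.2.1 : ℝ) = 0 := congrArg Complex.im h0
  rw [e1, e2] at hreal
  simp at hreal

theorem planeProj_ne_zero {x : SlabVertex k} (hx : 2 ≤ |x.1| ∨ 2 ≤ |x.2.1|) : planeProj x ≠ 0 := by
  intro h0
  have e1 : (x.1 : ℝ) = 0 := congrArg Complex.re h0
  have e2 : (x.2.1 : ℝ) = 0 := congrArg Complex.im h0
  have e1' : x.1 = 0 := by exact_mod_cast e1
  have e2' : x.2.1 = 0 := by exact_mod_cast e2
  rw [e1', e2'] at hx
  simp at hx

theorem angleStep_symm {x y : SlabVertex k} (h : PlaneStep (col x) (col y))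
    (hx : 2 ≤ |x.1| ∨ 2 ≤ |x.2.1|) : angleStep y x = -angleStep x y := by
  have h2 := abs_lt.1 (Complex.abs_arg_lt_pi_div_two_iff.2 (Or.inl (re_div_pos h hx)))
  rw [angleStep, angleStep, ← inv_div, Complex.arg_inv, if_neg]
  have := Real.pi_pos
  intro h
  linarith

theorem angleStep_eq_sub_of_right {x y : SlabVertex k} (h : PlaneStep (col x) (col y))
    (hx : 2 ≤ |x.1| ∨ 2 ≤ |x.2.1|) (hy : 2 ≤ |y.1| ∨ 2 ≤ |y.2.1|) (hx0 : 0 ≤ x.1) (hy0 : 0 ≤ y.1) :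
    angleStep x y = Complex.arg (planeProj y) - Complex.arg (planeProj x) :=
  arg_div_eq_sub (planeProj_ne_zero hx) (planeProj_ne_zero hy) (re_div_pos h hx)
    (Or.inl ⟨Int.cast_nonneg hx0, Int.cast_nonneg hy0⟩)

/-- The branch `arg (-z)` has its cut on the positive real axis, which such a step does not cross.
-/
theorem angleStep_eq_sub_of_left {x y : SlabVertex k} (h : PlaneStep (col x) (col y))
    (hx : 2 ≤ |x.1| ∨ 2 ≤ |x.2.1|) (hy : 2 ≤ |y.1| ∨ 2 ≤ |y.2.1|)
    (hxy : (x.1 ≤ 0 ∧ y.1 ≤ 0) ∨ (x.2.1 ≤ 0 ∧ y.2.1 ≤ 0) ∨ (0 < x.2.1 ∧ 0 < y.2.1)) :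
    angleStep x y = Complex.arg (-planeProj y) - Complex.arg (-planeProj x) := by
  rw [← arg_div_eq_sub (neg_ne_zero.2 (planeProj_ne_zero hx)) (neg_ne_zero.2 (planeProj_ne_zero hy)),
    neg_div_neg_eq, angleStep]
  · rw [neg_div_neg_eq]
    exact re_div_pos h hx
  · simp only [Complex.neg_re, Complex.neg_im, planeProj, neg_nonneg, neg_neg_iff_pos]
    exact_mod_cast hxy

end Angles

/-! ### The two arcs of cells, and the winding number of a double link -/

section Ring

/-- A path of cells around the right half of the annulus, from top to bottom. -/
def rightArc : List (ℤ × ℤ) :=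
  [(0, 5), (1, 5), (1, 4), (2, 4), (2, 5), (3, 5), (3, 4), (4, 4), (4, 3), (5, 3), (5, 2), (4, 2),
    (4, 1), (5, 1), (5, 0), (4, 0), (4, -1), (5, -1), (5, -2), (4, -2), (4, -3), (5, -3), (5, -4),
    (4, -4), (4, -5), (3, -5), (3, -4), (2, -4), (2, -5), (1, -5), (1, -4), (0, -4)]

/-- A path of cells around the left half of the annulus, from top to bottom. -/
def leftArc : List (ℤ × ℤ) :=
  [(0, 5), (0, 4), (-1, 4), (-1, 5), (-2, 5), (-2, 4), (-3, 4), (-3, 5), (-4, 5), (-4, 4), (-5, 4),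
    (-5, 3), (-4, 3), (-4, 2), (-5, 2), (-5, 1), (-4, 1), (-4, 0), (-5, 0), (-5, -1), (-4, -1),
    (-4, -2), (-5, -2), (-5, -3), (-4, -3), (-4, -4), (-3, -4), (-3, -5), (-2, -5), (-2, -4),
    (-1, -4), (-1, -5), (0, -5), (0, -4)]

instance decidableTurningPath (c₀ d₀ : ℤ × ℤ) : (L : List (ℤ × ℤ)) →
    Decidable (TurningPath c₀ d₀ L)
  | [] => isFalse id
  | [_] => isFalse id
  | [_, _] => inferInstanceAs (Decidable (_ ∧ _))
  | _ :: c :: c₁ :: L =>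
    have := decidableTurningPath c₀ d₀ (c :: c₁ :: L)
    inferInstanceAs (Decidable (_ ∧ _ ∧ _ ∧ _ ∧ _ ∧ _))

set_option maxRecDepth 100000 in
theorem turningPath_rightArc : TurningPath (0, -4) (-1, 0) rightArc := by decide +kernel

set_option maxRecDepth 100000 in
theorem turningPath_leftArc : TurningPath (0, -4) (0, 1) leftArc := by decide +kernel

/-- The cell `c` is contained in the annulus `A_{3n,6n}`. -/
def InRing (c : ℤ × ℤ) : Prop :=
  -6 ≤ c.1 ∧ c.1 ≤ 5 ∧ -6 ≤ c.2 ∧ c.2 ≤ 5 ∧ (4 ≤ c.1 ∨ c.1 ≤ -4 ∨ 4 ≤ c.2 ∨ c.2 ≤ -4)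

instance : DecidablePred InRing := fun _ => inferInstanceAs (Decidable (_ ∧ _ ∧ _ ∧ _ ∧ _))

theorem mem_annulus_of_inRing {n : ℕ} (hn : 0 < n) {x : SlabVertex k}
    (h : InRing (cellOf n (col x))) : x ∈ slabOver k (planeAnnulus (3 * n) (2 * (3 * n))) := by
  obtain ⟨c, hc⟩ : ∃ c, cellOf n (col x) = c := ⟨_, rfl⟩
  rw [hc] at h
  rw [cellOf_eq_iff hn] at hc
  obtain ⟨⟨h1, h2⟩, h3, h4⟩ := hc
  obtain ⟨h5, h6, h7, h8, h9⟩ := h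
  simp only [col] at h1 h2 h3 h4
  have hn' : (0 : ℤ) < n := by exact_mod_cast hn
  have e1 := mul_le_mul_of_nonneg_right h5 hn'.le
  have e2 := mul_le_mul_of_nonneg_right h6 hn'.le
  have e3 := mul_le_mul_of_nonneg_right h7 hn'.le
  have e4 := mul_le_mul_of_nonneg_right h8 hn'.le
  simp only [slabOver, planeAnnulus, planeBox, Set.mem_ofPred_eq, Set.mem_sdiff, Set.mem_prod,
    Set.mem_Icc]
  push_cast
  refine ⟨⟨⟨?_, ?_⟩, ?_, ?_⟩, ?_⟩
  · omega
  · omega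
  · omega
  · omega
  · rcases h9 with h9 | h9 | h9 | h9 <;> have e5 := mul_le_mul_of_nonneg_right h9 hn'.le <;> omega

theorem two_le_of_mem_annulus {n : ℕ} {x : SlabVertex k}
    (h : x ∈ slabOver k (planeAnnulus (3 * n) (2 * (3 * n)))) : 2 ≤ |x.1| ∨ 2 ≤ |x.2.1| := by
  simp only [slabOver, planeAnnulus, planeBox, Set.mem_ofPred_eq, Set.mem_sdiff, Set.mem_prod,
    Set.mem_Icc] at h
  push_cast at h
  simp only [le_abs]
  omega

theorem inRing_rightArc : ∀ pr ∈ rightArc.zip rightArc.tail,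
    (InRing pr.1 ∧ InRing pr.2) ∧ 0 ≤ pr.1.1 ∧ 0 ≤ pr.2.1 := by decide +kernel

theorem inRing_leftArc : ∀ pr ∈ leftArc.zip leftArc.tail, (InRing pr.1 ∧ InRing pr.2) ∧
    ((pr.1.1 ≤ -1 ∧ pr.2.1 ≤ -1) ∨ (pr.1.2 ≤ -1 ∧ pr.2.2 ≤ -1) ∨ (1 ≤ pr.1.2 ∧ 1 ≤ pr.2.2)) := by
  decide +kernel

theorem mul_natCast_le {n : ℕ} (hn : 0 < n) {a : ℤ} (h : a ≤ -1) : a * n + n ≤ 0 := by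
  have hn' : (0 : ℤ) < n := by exact_mod_cast hn
  nlinarith

theorem cellPathEdges_rightArc {n : ℕ} (hn : 0 < n) {x y : SlabVertex k}
    (h : s(x, y) ∈ cellPathEdges k n rightArc) :
    x ∈ slabOver k (planeAnnulus (3 * n) (2 * (3 * n))) ∧
      y ∈ slabOver k (planeAnnulus (3 * n) (2 * (3 * n))) ∧
      angleStep x y = Complex.arg (planeProj y) - Complex.arg (planeProj x) := by
  obtain ⟨hadj, pr, hpr, hxy⟩ := h
  obtain ⟨⟨hr1, hr2⟩, hp1, hp2⟩ := inRing_rightArc pr hpr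
  have key : ∀ z ∈ s(x, y), z ∈ slabOver k (planeAnnulus (3 * n) (2 * (3 * n))) ∧ 0 ≤ z.1 := by
    intro z hz
    have hcell : InRing (cellOf n (col z)) ∧ 0 ≤ (cellOf n (col z)).1 := by
      rcases hxy z hz with h | h <;> rw [h]
      · exact ⟨hr1, hp1⟩
      · exact ⟨hr2, hp2⟩
    refine ⟨mem_annulus_of_inRing hn hcell.1, ?_⟩
    have := (cellOf_eq_iff hn (z := col z)).1 rfl
    exact (mul_nonneg hcell.2 (Int.natCast_nonneg n)).trans this.1.1
  obtain ⟨hx, hx0⟩ := key x (by simp)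
  obtain ⟨hy, hy0⟩ := key y (by simp)
  exact ⟨hx, hy, angleStep_eq_sub_of_right (planeStep_of_adj hadj) (two_le_of_mem_annulus hx)
    (two_le_of_mem_annulus hy) hx0 hy0⟩

theorem cellPathEdges_leftArc {n : ℕ} (hn : 0 < n) {x y : SlabVertex k}
    (h : s(x, y) ∈ cellPathEdges k n leftArc) :
    x ∈ slabOver k (planeAnnulus (3 * n) (2 * (3 * n))) ∧
      y ∈ slabOver k (planeAnnulus (3 * n) (2 * (3 * n))) ∧
      angleStep x y = Complex.arg (-planeProj y) - Complex.arg (-planeProj x) := by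
  obtain ⟨hadj, pr, hpr, hxy⟩ := h
  obtain ⟨⟨hr1, hr2⟩, hp⟩ := inRing_leftArc pr hpr
  have hn' : (0 : ℤ) < n := by exact_mod_cast hn
  have hring : ∀ z ∈ s(x, y), z ∈ slabOver k (planeAnnulus (3 * n) (2 * (3 * n))) := by
    intro z hz
    refine mem_annulus_of_inRing hn ?_
    rcases hxy z hz with h | h <;> rw [h]
    · exact hr1
    · exact hr2
  have key : (∀ z ∈ s(x, y), z.1 ≤ 0) ∨ (∀ z ∈ s(x, y), z.2.1 ≤ 0) ∨ ∀ z ∈ s(x, y), 0 < z.2.1 := by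
    rcases hp with ⟨h1, h2⟩ | ⟨h1, h2⟩ | ⟨h1, h2⟩
    · refine Or.inl fun z hz => ?_
      rcases hxy z hz with h | h <;> have h' := ((cellOf_eq_iff hn).1 h).1.2
      · exact h'.le.trans (mul_natCast_le hn h1)
      · exact h'.le.trans (mul_natCast_le hn h2)
    · refine Or.inr (Or.inl fun z hz => ?_)
      rcases hxy z hz with h | h <;> have h' := ((cellOf_eq_iff hn).1 h).2.2
      · exact h'.le.trans (mul_natCast_le hn h1)
      · exact h'.le.trans (mul_natCast_le hn h2)
    · refine Or.inr (Or.inr fun z hz => ?_)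
      rcases hxy z hz with h | h <;> have h' := ((cellOf_eq_iff hn).1 h).2.1
      · exact (mul_pos (by omega) hn').trans_le h'
      · exact (mul_pos (by omega) hn').trans_le h'
  have hx := hring x (by simp)
  have hy := hring y (by simp)
  refine ⟨hx, hy, angleStep_eq_sub_of_left (planeStep_of_adj hadj) (two_le_of_mem_annulus hx)
    (two_le_of_mem_annulus hy) ?_⟩
  rcases key with h | h | h
  · exact Or.inl ⟨h x (by simp), h y (by simp)⟩
  · exact Or.inr (Or.inl ⟨h x (by simp), h y (by simp)⟩)
  · exact Or.inr (Or.inr ⟨h x (by simp), h y (by simp)⟩)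

/-- The open edges of a configuration. -/
def openEdges (ω : BondConfig k) : Set (Sym2 (SlabVertex k)) :=
  {e | ∃ h : e ∈ (slab k).edgeSet, ω ⟨e, h⟩ = true}

/-- The closed walk goes down the right arc and up the left arc, twice. On the right the angle is
measured by `arg z`, on the left by `arg (-z)`; these branches differ by `π` at the bottom cell and
by `-π` at the top cell, so each turn contributes `-2π`. -/
theorem mem_circuitEvent_of_doublyLinked {n : ℕ} (hn : 0 < n) {ω : BondConfig k}
    {S : Set (Sym2 (SlabVertex k))} (hS : S ⊆ openEdges ω)
    (h : DoublyLinked S (cellPathEdges k n rightArc) (cellPathEdges k n leftArc)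
      {z | cellOf n z = (0, -4)} {z | cellOf n z = (0, 5)}) : ω ∈ circuitEvent k (3 * n) := by
  obtain ⟨m, m', hm, hm', ⟨q, hq, hmq, hmq'⟩, q', hq', hmq₂, hmq₂'⟩ := h
  set R := slabOver k (planeAnnulus (3 * n) (2 * (3 * n))) with hR
  have hring : ∀ {x : SlabVertex k} {c : ℤ × ℤ}, cellOf n (col x) = c → InRing c → x ∈ R :=
    fun hx hc => mem_annulus_of_inRing hn (hx ▸ hc)
  have hright : ∀ x y : SlabVertex k, x ∈ R → Reach (S ∩ cellPathEdges k n rightArc) x y →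
      ∃ p : (openGraph ω).Walk x y, (∀ z ∈ p.support, z ∈ R) ∧
        walkSum angleStep p = Complex.arg (planeProj y) - Complex.arg (planeProj x) :=
    fun x y hx h => exists_walk_of_reach (θ := fun x => Complex.arg (planeProj x))
      (fun a b hab => ⟨hS hab.1, cellPathEdges_rightArc hn hab.2⟩) hx h
  have hleft : ∀ x y : SlabVertex k, x ∈ R → Reach (S ∩ cellPathEdges k n leftArc) x y →
      ∃ p : (openGraph ω).Walk x y, (∀ z ∈ p.support, z ∈ R) ∧
        walkSum angleStep p = Complex.arg (-planeProj y) - Complex.arg (-planeProj x) :=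
    fun x y hx h => exists_walk_of_reach (θ := fun x => Complex.arg (-planeProj x))
      (fun a b hab => ⟨hS hab.1, cellPathEdges_leftArc hn hab.2⟩) hx h
  have hbot : ∀ x : SlabVertex k, cellOf n (col x) = (0, -4) →
      Complex.arg (-planeProj x) = Complex.arg (planeProj x) + Real.pi := by
    intro x hx
    refine Complex.arg_neg_eq_arg_add_pi_of_im_neg ?_
    have h1 := ((cellOf_eq_iff hn).1 hx).2.2
    have h2 : x.2.1 < 0 := h1.trans_le (by push_cast; omega)
    exact Int.cast_lt_zero.2 h2
  have htop : ∀ x : SlabVertex k, cellOf n (col x) = (0, 5) →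
      Complex.arg (-planeProj x) = Complex.arg (planeProj x) - Real.pi := by
    intro x hx
    refine Complex.arg_neg_eq_arg_sub_pi_of_im_pos ?_
    have h1 := ((cellOf_eq_iff hn).1 hx).2.1
    have h2 : 0 < x.2.1 := lt_of_lt_of_le (by push_cast; omega) h1
    exact Int.cast_pos.2 h2
  have hmR : m ∈ R := hring hm (by decide)
  have hmR' : m' ∈ R := hring hm' (by decide)
  have hqR : q ∈ R := hring hq (by decide)
  have hqR' : q' ∈ R := hring hq' (by decide)
  obtain ⟨p₁, hp₁, e₁⟩ := hright m q hmR hmq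
  obtain ⟨p₂, hp₂, e₂⟩ := hleft q m' hqR hmq'.symm
  obtain ⟨p₃, hp₃, e₃⟩ := hright m' q' hmR' hmq₂
  obtain ⟨p₄, hp₄, e₄⟩ := hleft q' m hqR' hmq₂'.symm
  have hsum : walkSum angleStep ((p₁.append p₂).append (p₃.append p₄)) = -(4 * Real.pi) := by
    rw [walkSum_append, walkSum_append, walkSum_append, e₁, e₂, e₃, e₄, hbot q hq, hbot q' hq',
      htop m hm, htop m' hm']
    ring
  obtain ⟨w, c, hc, hcR, hc0⟩ := exists_isCycle_of_walkSum_ne_zero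
    (G := openGraph ω) (f := angleStep) (R := R)
    (fun a ha b hb hab => angleStep_symm (planeStep_of_adj hab.1) (two_le_of_mem_annulus ha))
    ((p₁.append p₂).append (p₃.append p₄))
    (by
      intro x hx
      simp only [SimpleGraph.Walk.mem_support_append_iff] at hx
      rcases hx with (hx | hx) | hx | hx
      · exact hp₁ x hx
      · exact hp₂ x hx
      · exact hp₃ x hx
      · exact hp₄ x hx)
    (by
      rw [hsum]
      exact neg_ne_zero.2 (mul_ne_zero (by norm_num) Real.pi_ne_zero))
  exact ⟨w, c, hc, hcR, div_ne_zero hc0 (mul_ne_zero two_ne_zero Real.pi_ne_zero)⟩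

end Ring

/-! ### From the product measure to finite sums, and invariance under automorphisms -/

section MeasureBridge

instance (p : unitInterval) : IsProbabilityMeasure (bondPercolation k p) :=
  inferInstanceAs (IsProbabilityMeasure (Measure.infinitePi _))

open Classical in
/-- The configurations whose restriction to `Λ` is `S`. -/
noncomputable def cylinderOver (Λ S : Finset (Sym2 (SlabVertex k))) : Set (BondConfig k) :=
  Set.pi ↑(Λ.subtype (· ∈ (slab k).edgeSet)) fun e => {b | b = true ↔ ↑e ∈ S}

theorem mem_cylinderOver {Λ S : Finset (Sym2 (SlabVertex k))} (hΛ : ↑Λ ⊆ (slab k).edgeSet)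
    (hS : S ⊆ Λ) {ω : BondConfig k} : ω ∈ cylinderOver Λ S ↔ openEdges ω ∩ ↑Λ = ↑S := by
  classical
  simp only [cylinderOver, Set.mem_pi, Finset.mem_coe, Finset.mem_subtype, Subtype.forall]
  constructor
  · intro h
    ext e
    constructor
    · rintro ⟨⟨he, ho⟩, heΛ⟩
      exact (h e he heΛ).1 ho
    · intro heS
      exact ⟨⟨hΛ (hS heS), (h e (hΛ (hS heS)) (hS heS)).2 heS⟩, hS heS⟩
  · intro h e he heΛ
    have : e ∈ openEdges ω ∩ ↑Λ ↔ e ∈ (↑S : Set (Sym2 (SlabVertex k))) := by rw [h]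
    constructor
    · exact fun ho => this.1 ⟨⟨he, ho⟩, heΛ⟩
    · exact fun heS => (this.2 heS).1.2

theorem measurableSet_cylinderOver (Λ S : Finset (Sym2 (SlabVertex k))) :
    MeasurableSet (cylinderOver Λ S) :=
  MeasurableSet.pi (Finset.countable_toSet _) fun _ _ => MeasurableSet.of_discrete

theorem real_cylinderOver (p : unitInterval) {Λ S : Finset (Sym2 (SlabVertex k))}
    (hΛ : ↑Λ ⊆ (slab k).edgeSet) :
    (bondPercolation k p).real (cylinderOver Λ S) = weight p Λ S := by
  classical
  rw [cylinderOver, bondPercolation, Measure.real, Measure.infinitePi_pi, ENNReal.toReal_prod,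
    weight, ← Finset.prod_subtype_of_mem _ (p := (· ∈ (slab k).edgeSet)) (fun e he => hΛ he)]
  · refine Finset.prod_congr (by congr!) fun e _ => ?_
    by_cases he : ↑e ∈ S
    · rw [if_pos he, ← Measure.real]
      exact bernoulliMeasure_real_apply_of_mem_of_notMem p MeasurableSet.of_discrete
        (by simp [he]) (by simp [he])
    · rw [if_neg he, ← Measure.real]
      exact bernoulliMeasure_real_apply_of_notMem_of_mem p MeasurableSet.of_discrete
        (by simp [he]) (by simp [he])
  · exact fun _ _ => MeasurableSet.of_discrete

/-- An event determined by the edges of `Λ` is a finite disjoint union of cylinders, each with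
product weight. -/
theorem real_eq_prob (p : unitInterval) {Λ : Finset (Sym2 (SlabVertex k))}
    (hΛ : ↑Λ ⊆ (slab k).edgeSet) (X : Set (Sym2 (SlabVertex k)) → Prop) :
    (bondPercolation k p).real {ω | X (openEdges ω ∩ ↑Λ)} = prob p Λ X := by
  classical
  have h : {ω : BondConfig k | X (openEdges ω ∩ ↑Λ)} = ⋃ S ∈ configs Λ X, cylinderOver Λ S := by
    ext ω
    simp only [Set.mem_ofPred_eq, Set.mem_iUnion, exists_prop]
    constructor
    · intro hX
      have hcoe : (↑(Λ.filter (· ∈ openEdges ω)) : Set (Sym2 (SlabVertex k))) =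
          openEdges ω ∩ ↑Λ := by
        ext e
        simp [and_comm]
      exact ⟨Λ.filter (· ∈ openEdges ω), mem_configs.2 ⟨Finset.filter_subset _ _, by rwa [hcoe]⟩,
        (mem_cylinderOver hΛ (Finset.filter_subset _ _)).2 hcoe.symm⟩
    · rintro ⟨S, hS, hω⟩
      rw [mem_configs] at hS
      rw [(mem_cylinderOver hΛ hS.1).1 hω]
      exact hS.2
  rw [h, measureReal_biUnion_finset]
  · exact Finset.sum_congr rfl fun S _ => real_cylinderOver p hΛ
  · intro S hS T hT hST
    refine Set.disjoint_left.2 fun ω h1 h2 => hST ?_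
    rw [Finset.mem_coe, mem_configs] at hS hT
    have e1 := (mem_cylinderOver hΛ hS.1).1 h1
    have e2 := (mem_cylinderOver hΛ hT.1).1 h2
    exact Finset.coe_injective (e1.symm.trans e2)
  · exact fun S _ => measurableSet_cylinderOver Λ S

/-- The probability of a connection is not decreased by an automorphism of the slab. -/
theorem real_joined_le_of_iso (p : unitInterval) (φ : slab k ≃g slab k)
    {D D' : Set (Sym2 (SlabVertex k))} {A A' B B' : Set (SlabVertex k)}
    (hD : ∀ x y, s(x, y) ∈ D → s(φ x, φ y) ∈ D') (hA : ∀ x ∈ A, φ x ∈ A')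
    (hB : ∀ x ∈ B, φ x ∈ B') :
    (bondPercolation k p).real {ω | Joined (openEdges ω) D A B} ≤
      (bondPercolation k p).real {ω | Joined (openEdges ω) D' A' B'} := by
  set f := MeasurableEquiv.piCongrLeft (fun _ : (slab k).edgeSet => Bool) φ.mapEdgeSet with hf
  have hmap : (bondPercolation k p).map f = bondPercolation k p :=
    Measure.infinitePi_map_piCongrLeft (fun _ : (slab k).edgeSet => bernoulliMeasure true false p)
      φ.mapEdgeSet
  have hpre : {ω | Joined (openEdges ω) D A B} ⊆
      f ⁻¹' {ω | Joined (openEdges ω) D' A' B'} := by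
    rintro ω ⟨a, ha, b, hb, hab⟩
    refine ⟨φ a, hA a ha, φ b, hB b hb, ?_⟩
    refine Relation.ReflTransGen.lift φ (fun x y hxy => ?_) _ _ hab
    obtain ⟨⟨h, ho⟩, hxD⟩ := hxy
    refine ⟨⟨φ.map_adj_iff.2 h, ?_⟩, hD x y hxD⟩
    have := Equiv.piCongrLeft_apply_apply (fun _ : (slab k).edgeSet => Bool) φ.mapEdgeSet ω
      ⟨s(x, y), h⟩
    rw [← ho, ← this]
    rfl
  calc _ ≤ (bondPercolation k p).real (f ⁻¹' {ω | Joined (openEdges ω) D' A' B'}) :=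
        measureReal_mono hpre
    -- For a measurable equivalence this holds for every set, so the event need not be shown
    -- measurable.
    _ = ((bondPercolation k p).map f).real {ω | Joined (openEdges ω) D' A' B'} := by
        rw [Measure.real, Measure.real, f.map_apply]
    _ = _ := by rw [hmap]

end MeasureBridge

/-! ### Crossing probabilities of dominoes -/

section Dominoes

/-- Translations of the slab. -/
def shiftIso (k : ℕ) (a : ℤ × ℤ) : slab k ≃g slab k where
  toFun x := (x.1 + a.1, x.2.1 + a.2, x.2.2)
  invFun x := (x.1 - a.1, x.2.1 - a.2, x.2.2)
  left_inv x := by simp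
  right_inv x := by simp
  map_rel_iff' {x y} := by simp [slab]

/-- The reflection of the slab that exchanges the two horizontal coordinates. -/
def swapIso (k : ℕ) : slab k ≃g slab k where
  toFun x := (x.2.1, x.1, x.2.2)
  invFun x := (x.2.1, x.1, x.2.2)
  left_inv _ := rfl
  right_inv _ := rfl
  map_rel_iff' {x y} := by
    simp only [slab, Equiv.coe_fn_mk]
    rw [add_comm ((x.2.1 - y.2.1) ^ 2)]

theorem cellOf_add {n : ℕ} (hn : 0 < n) (z c : ℤ × ℤ) :
    cellOf n (z + (c.1 * n, c.2 * n)) = cellOf n z + c := by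
  have hn' : (n : ℤ) ≠ 0 := by exact_mod_cast hn.ne'
  simp [cellOf, Int.add_mul_ediv_right _ _ hn', Prod.ext_iff]

theorem cellOf_swap (n : ℕ) (z : ℤ × ℤ) : cellOf n z.swap = (cellOf n z).swap := rfl

theorem real_domino_shift (p : unitInterval) {n : ℕ} (hn : 0 < n) (c c₀ c₁ d₀ d₁ : ℤ × ℤ) :
    (bondPercolation k p).real {ω | Joined (openEdges ω) (cellPathEdges k n [c₀, c₁])
        (wall k n c₀ d₀) (wall k n c₁ d₁)} ≤
      (bondPercolation k p).real {ω | Joined (openEdges ω) (cellPathEdges k n [c₀ + c, c₁ + c])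
        (wall k n (c₀ + c) d₀) (wall k n (c₁ + c) d₁)} := by
  have hcol : ∀ x, col (shiftIso k (c.1 * n, c.2 * n) x) = col x + (c.1 * n, c.2 * n) :=
    fun _ => rfl
  have hwall : ∀ c₀ d₀, ∀ x ∈ wall k n c₀ d₀,
      shiftIso k (c.1 * n, c.2 * n) x ∈ wall k n (c₀ + c) d₀ := by
    rintro c₀ d₀ x ⟨h1, h2⟩
    refine ⟨?_, ?_⟩
    · rw [hcol, cellOf_add hn, h1]
    · rw [hcol, add_right_comm, cellOf_add hn]
      exact fun h => h2 (add_right_cancel h)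
  refine real_joined_le_of_iso p (shiftIso k (c.1 * n, c.2 * n)) ?_ (hwall _ _) (hwall _ _)
  rintro x y ⟨hadj, pr, hpr, h⟩
  obtain rfl : pr = (c₀, c₁) := by simpa using hpr
  refine ⟨(shiftIso k (c.1 * n, c.2 * n)).map_adj_iff.2 hadj, (c₀ + c, c₁ + c), by simp, ?_⟩
  intro z hz
  rcases Sym2.mem_iff.1 hz with rfl | rfl <;> rw [hcol, cellOf_add hn]
  · simpa using h x (by simp)
  · simpa using h y (by simp)

theorem real_domino_swap (p : unitInterval) (n : ℕ) (c₀ c₁ d₀ d₁ : ℤ × ℤ) :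
    (bondPercolation k p).real {ω | Joined (openEdges ω) (cellPathEdges k n [c₀, c₁])
        (wall k n c₀ d₀) (wall k n c₁ d₁)} ≤
      (bondPercolation k p).real {ω | Joined (openEdges ω) (cellPathEdges k n [c₀.swap, c₁.swap])
        (wall k n c₀.swap d₀.swap) (wall k n c₁.swap d₁.swap)} := by
  have hcol : ∀ x, col (swapIso k x) = (col x).swap := fun _ => rfl
  have hwall : ∀ c₀ d₀, ∀ x ∈ wall k n c₀ d₀, swapIso k x ∈ wall k n c₀.swap d₀.swap := by
    rintro c₀ d₀ x ⟨h1, h2⟩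
    refine ⟨?_, ?_⟩
    · rw [hcol, cellOf_swap, h1]
    · rw [hcol, ← Prod.swap_add, cellOf_swap]
      exact fun h => h2 (Prod.swap_injective h)
  refine real_joined_le_of_iso p (swapIso k) ?_ (hwall _ _) (hwall _ _)
  rintro x y ⟨hadj, pr, hpr, h⟩
  obtain rfl : pr = (c₀, c₁) := by simpa using hpr
  refine ⟨(swapIso k).map_adj_iff.2 hadj, (c₀.swap, c₁.swap), by simp, ?_⟩
  intro z hz
  rcases Sym2.mem_iff.1 hz with rfl | rfl <;> rw [hcol, cellOf_swap]
  · simpa using h x (by simp)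
  · simpa using h y (by simp)

theorem exists_reach_of_walk {n : ℕ} (hn : 0 < n) {ω : BondConfig k} {u v : SlabVertex k}
    (γ : (openGraph ω).Walk u v)
    (hγ : ∀ x ∈ γ.support, (0 ≤ x.1 ∧ x.1 ≤ 2 * n) ∧ 0 ≤ x.2.1 ∧ x.2.1 ≤ n - 1)
    (hu : u.1 ≤ 2 * n - 1) (hv : v.1 = 2 * n) :
    ∃ w : SlabVertex k, w.1 = 2 * n - 1 ∧ (0 ≤ w.2.1 ∧ w.2.1 ≤ n - 1) ∧
      Reach (openEdges ω ∩ cellPathEdges k n [(0, 0), (1, 0)]) u w := by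
  induction γ with
  | nil => omega
  | @cons a b c h γ ih =>
    rw [SimpleGraph.Walk.support_cons, List.forall_mem_cons] at hγ
    have hb := hγ.2 b γ.start_mem_support
    have hcell : ∀ x : SlabVertex k, ((0 ≤ x.1 ∧ x.1 ≤ 2 * n) ∧ 0 ≤ x.2.1 ∧ x.2.1 ≤ n - 1) →
        x.1 ≤ 2 * n - 1 → cellOf n (col x) = (0, 0) ∨ cellOf n (col x) = (1, 0) := by
      intro x hx hx'
      rw [cellOf_eq_iff hn, cellOf_eq_iff hn]
      simp only [col]
      omega
    by_cases hb' : b.1 ≤ 2 * n - 1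
    · obtain ⟨w, hw, hw', hr⟩ := ih hγ.2 hb' hv
      have hab : s(a, b) ∈ openEdges ω ∩ cellPathEdges k n [(0, 0), (1, 0)] := by
        refine ⟨h, h.1, ((0, 0), (1, 0)), by simp, fun x hx => ?_⟩
        rcases Sym2.mem_iff.1 hx with rfl | rfl
        · exact hcell _ hγ.1 hu
        · exact hcell _ hb hb'
      exact ⟨w, hw, hw', (Reach.single hab).trans hr⟩
    -- The rectangle has `2n + 1` columns and the domino `2n`. The walk is stopped just before its
    -- first step into column `2n`, hence in column `2n - 1`.
    · have := adj_col h.1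
      exact ⟨a, by omega, hγ.1.2, Reach.refl a⟩

theorem crossingProb_le (p : unitInterval) {n : ℕ} (hn : 0 < n) :
    crossingProb k p (2 * n) (n - 1) ≤ (bondPercolation k p).real {ω | Joined (openEdges ω)
      (cellPathEdges k n [(0, 0), (1, 0)]) (wall k n (0, 0) (-1, 0)) (wall k n (1, 0) (1, 0))} := by
  refine measureReal_mono ?_
  rintro ω ⟨u, hu, v, hv, γ, hγ⟩
  have hcast : ((n - 1 : ℕ) : ℤ) = n - 1 := by omega
  simp only [slabOver, Set.mem_ofPred_eq, Set.mem_prod, Set.mem_Icc, Set.mem_singleton_iff, hcast,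
    Nat.cast_mul, Nat.cast_ofNat] at hu hv hγ
  obtain ⟨w, hw, hw', hr⟩ := exists_reach_of_walk hn γ hγ (by omega) hv.1
  refine ⟨u, ⟨?_, ?_⟩, w, ⟨?_, ?_⟩, hr⟩
  all_goals
    try rw [Ne]
    rw [cellOf_eq_iff hn]
    simp only [col, Prod.fst_add, Prod.snd_add]
    omega

theorem cellPathEdges_pair_comm (n : ℕ) (c c' : ℤ × ℤ) :
    cellPathEdges k n [c, c'] = cellPathEdges k n [c', c] := by
  ext e
  simp [cellPathEdges, or_comm]

theorem crossingProb_le_domino (p : unitInterval) {n : ℕ} (hn : 0 < n) {c c' : ℤ × ℤ}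
    (h : IsDirection (c' - c)) :
    crossingProb k p (2 * n) (n - 1) ≤ (bondPercolation k p).real {ω | Joined (openEdges ω)
      (cellPathEdges k n [c', c]) (wall k n c' (c' - c)) (wall k n c (c - c'))} := by
  wlog hd : c - c' = (1, 0) ∨ c - c' = (0, 1) generalizing c c'
  · have h' : IsDirection (c - c') := by
      rw [← neg_sub]
      rcases h with h | h | h | h <;> rw [h] <;> decide
    have hd' : c' - c = (1, 0) ∨ c' - c = (0, 1) := by
      rw [← neg_sub] at hd ⊢
      rcases h' with h' | h' | h' | h' <;> simp_all
    refine (this h' hd').trans (measureReal_mono fun ω hω => ?_)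
    have := Joined.symm hω
    rwa [cellPathEdges_pair_comm] at this
  have hH := crossingProb_le (k := k) p hn
  have h0 : ((0, 0) : ℤ × ℤ) + c' = c' := zero_add c'
  rcases hd with hd | hd
  · have := hH.trans (real_domino_shift p hn c' (0, 0) (1, 0) (-1, 0) (1, 0))
    rw [← neg_sub c c', hd, (sub_eq_iff_eq_add.1 hd)]
    simpa [h0] using this
  · have := (hH.trans (real_domino_swap p n (0, 0) (1, 0) (-1, 0) (1, 0))).trans
      (real_domino_shift p hn c' _ _ _ _)
    rw [← neg_sub c c', hd, (sub_eq_iff_eq_add.1 hd)]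
    simpa [h0] using this

end Dominoes

/-! ### Assembly of the circuit -/

section Assembly

theorem finite_cellPathEdges (n : ℕ) (hn : 0 < n) (L : List (ℤ × ℤ)) :
    (cellPathEdges k n L).Finite := by
  have hcell : ∀ c : ℤ × ℤ, {x : SlabVertex k | cellOf n (col x) = c}.Finite := by
    intro c
    refine (((Set.finite_Icc (c.1 * n) (c.1 * n + n)).prod
      ((Set.finite_Icc (c.2 * n) (c.2 * n + n)).prod Set.finite_univ))).subset fun x hx => ?_
    have hx' := (cellOf_eq_iff hn).1 hx
    exact ⟨⟨hx'.1.1, hx'.1.2.le⟩, ⟨hx'.2.1, hx'.2.2.le⟩, Set.mem_univ _⟩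
  have hpair : ∀ pr : (ℤ × ℤ) × ℤ × ℤ, {e : Sym2 (SlabVertex k) | ∀ x ∈ e,
      cellOf n (col x) = pr.1 ∨ cellOf n (col x) = pr.2}.Finite := by
    intro pr
    have hU := (hcell pr.1).union (hcell pr.2)
    refine ((hU.prod hU).image fun t => s(t.1, t.2)).subset ?_
    intro e
    induction e with
    | _ a b => exact fun he => ⟨(a, b), ⟨he a (by simp), he b (by simp)⟩, rfl⟩
  refine (Set.Finite.biUnion (List.finite_toSet (L.zip L.tail)) fun pr _ => hpair pr).subset ?_
  rintro e ⟨-, pr, hpr, h⟩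
  exact Set.mem_biUnion (x := pr) hpr h

/-- Every pair of consecutive cells of `L` that contains `c` consists of `c` and `c₁`. -/
def HasEnd (L : List (ℤ × ℤ)) (c c₁ : ℤ × ℤ) : Prop :=
  (∃ pr ∈ L.zip L.tail, c = pr.1 ∨ c = pr.2) ∧
    ∀ pr ∈ L.zip L.tail, (pr.1 = c → pr.2 = c₁) ∧ (pr.2 = c → pr.1 = c₁)

instance (L : List (ℤ × ℤ)) (c c₁ : ℤ × ℤ) : Decidable (HasEnd L c c₁) :=
  inferInstanceAs (Decidable (_ ∧ _))

/-- In both end cells, `(0, 5)` and `(0, -4)`, the right arc uses only a horizontal neighbour and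
the left arc only a vertical one, so the two arcs cross these cells in perpendicular directions. -/
theorem hasEnd_rightArc_top : HasEnd rightArc (0, 5) ((0, 5) + (1, 0)) := by decide +kernel

theorem hasEnd_leftArc_top : HasEnd leftArc (0, 5) ((0, 5) + (0, -1)) := by decide +kernel

theorem hasEnd_rightArc_bottom : HasEnd rightArc (0, -4) ((0, -4) + (1, 0)) := by decide +kernel

theorem hasEnd_leftArc_bottom : HasEnd leftArc (0, -4) ((0, -4) + (0, -1)) := by decide +kernel

theorem isDirection_rightArc : ∀ pr ∈ rightArc.zip rightArc.tail, IsDirection (pr.1 - pr.2) := by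
  decide +kernel

theorem isDirection_leftArc : ∀ pr ∈ leftArc.zip leftArc.tail, IsDirection (pr.1 - pr.2) := by
  decide +kernel

theorem HasEnd.containsVertical {L : List (ℤ × ℤ)} {c c₁ : ℤ × ℤ} (h : HasEnd L c c₁) (n : ℕ) :
    ContainsVertical (cellPathEdges k n L) {z | cellOf n z = c} := by
  obtain ⟨⟨pr, hpr, h⟩, -⟩ := h
  exact containsVertical_cellPathEdges hpr h

theorem HasEnd.forcedCrossing {n : ℕ} (hn : 0 < n) {L L' : List (ℤ × ℤ)} {c : ℤ × ℤ}
    (h : HasEnd L c (c + (1, 0))) (h' : HasEnd L' c (c + (0, -1))) {A C : Set (SlabVertex k)}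
    (hA : ∀ a ∈ A, cellOf n (col a) ≠ c) (hC : ∀ a ∈ C, cellOf n (col a) ≠ c) :
    ForcedCrossing (cellPathEdges k n L) (cellPathEdges k n L') A (wall k n c (-1, 0)) C
      (wall k n c (0, 1)) {z | cellOf n z = c} :=
  forcedCrossing_of_enters hn (fun _ _ => adj_of_mem_cellPathEdges)
    (fun _ _ => adj_of_mem_cellPathEdges) (by decide) (by decide) (by decide)
    (enters_cellPathEdges h.2) (enters_cellPathEdges h'.2) hA hC

theorem cellPathEdges_mem_zip_subset (n : ℕ) {L : List (ℤ × ℤ)} {pr : (ℤ × ℤ) × ℤ × ℤ}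
    (hpr : pr ∈ L.zip L.tail) : cellPathEdges k n [pr.1, pr.2] ⊆ cellPathEdges k n L := by
  rintro e ⟨he, pr', hpr', h⟩
  obtain rfl : pr' = pr := by simpa using hpr'
  exact ⟨he, pr', hpr, h⟩

theorem prob_arc {p δ κ : ℝ} {Λ : Finset (Sym2 (SlabVertex k))} {n : ℕ} (hn : 0 < n)
    (hδ : 0 < δ) (hp : δ ≤ p) (hp' : δ ≤ 1 - p) (hκ : 0 ≤ κ)
    (hΛ : ∀ x y, s(x, y) ∈ Λ → (slab k).Adj x y)
    (hdom : ∀ c c', cellPathEdges k n [c', c] ⊆ ↑Λ → IsDirection (c' - c) → κ ≤ prob p Λ fun S =>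
      Joined S (cellPathEdges k n [c', c]) (wall k n c' (c' - c)) (wall k n c (c - c')))
    {L A : List (ℤ × ℤ)} {c₀ d₀ c c' d : ℤ × ℤ} (hA : A = c' :: c :: L) {m : ℕ} (hm : L.length = m)
    (hL : TurningPath c₀ d₀ A) (hLΛ : cellPathEdges k n A ⊆ ↑Λ)
    (hdir : ∀ pr ∈ A.zip A.tail, IsDirection (pr.1 - pr.2)) (hd : c' - c = d) :
    κ * (κ / (1 + surgeryCost k δ)) ^ m ≤ prob p Λ fun S =>
      Joined S (cellPathEdges k n A) (wall k n c₀ d₀) (wall k n c' d) := by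
  subst hA hd hm
  exact prob_cellPath hn hδ hp hp' hκ hΛ hL hLΛ fun pr hpr =>
    hdom _ _ ((cellPathEdges_mem_zip_subset n hpr).trans hLΛ) (hdir pr hpr)

/-- Harris' inequality gives both arcs together; gluing in the top cell yields a joint, and closing
in the bottom cell a double link. These two operations account for the square. The exponents are the
numbers of cells of the arcs, less two. -/
theorem prob_doublyLinked {p δ κ : ℝ} {Λ : Finset (Sym2 (SlabVertex k))} {n : ℕ} (hn : 0 < n)
    (hδ : 0 < δ) (hp : δ ≤ p) (hp' : δ ≤ 1 - p) (hκ : 0 ≤ κ)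
    (hΛ : ∀ x y, s(x, y) ∈ Λ → (slab k).Adj x y) (hr : cellPathEdges k n rightArc ⊆ ↑Λ)
    (hl : cellPathEdges k n leftArc ⊆ ↑Λ)
    (hdom : ∀ c c', cellPathEdges k n [c', c] ⊆ ↑Λ → IsDirection (c' - c) → κ ≤ prob p Λ fun S =>
      Joined S (cellPathEdges k n [c', c]) (wall k n c' (c' - c)) (wall k n c (c - c'))) :
    κ * (κ / (1 + surgeryCost k δ)) ^ 30 * (κ * (κ / (1 + surgeryCost k δ)) ^ 32) /
        (1 + surgeryCost k δ) ^ 2 ≤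
      prob p Λ fun S => DoublyLinked S (cellPathEdges k n rightArc) (cellPathEdges k n leftArc)
        {z | cellOf n z = (0, -4)} {z | cellOf n z = (0, 5)} := by
  have h0 : 0 ≤ p := by linarith
  have h1 : p ≤ 1 := by linarith
  have hcost : 0 < 1 + surgeryCost k δ := by
    have := surgeryCost_nonneg (k := k) hδ
    linarith
  have hR := prob_arc hn hδ hp hp' hκ hΛ hdom (A := rightArc) (d := (-1, 0)) rfl (m := 30)
    rfl turningPath_rightArc hr isDirection_rightArc (by decide)
  have hL := prob_arc hn hδ hp hp' hκ hΛ hdom (A := leftArc) (d := (0, 1)) rfl (m := 32) rfl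
    turningPath_leftArc hl isDirection_leftArc (by decide)
  have hfkg := prob_mul_le (Λ := Λ) h0 h1
    (monotone_joined (cellPathEdges k n rightArc) (wall k n (0, -4) (-1, 0))
      (wall k n (0, 5) (-1, 0)))
    (monotone_joined (cellPathEdges k n leftArc) (wall k n (0, -4) (0, 1)) (wall k n (0, 5) (0, 1)))
  have hoff : ∀ d : ℤ × ℤ, ∀ a ∈ wall k n (0, -4) d, cellOf n (col a) ≠ (0, 5) := by
    intro d a ha h
    have := ha.1.symm.trans h
    simp at this
  have htop := prob_le_of_forcedCrossing hδ hp hp' hΛ hr hl (hasEnd_rightArc_top.containsVertical n)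
    (hasEnd_leftArc_top.containsVertical n) (hoff (-1, 0)) (hoff (0, 1))
    (hasEnd_rightArc_top.forcedCrossing hn hasEnd_leftArc_top (hoff _) (hoff _))
  have hjoint : prob p Λ (fun S => ∃ w, col w ∈ {z | cellOf n z = (0, 5)} ∧
      (∃ a ∈ wall k n (0, -4) (-1, 0), Reach (S ∩ cellPathEdges k n rightArc) a w) ∧
        ∃ a ∈ wall k n (0, -4) (0, 1), Reach (S ∩ cellPathEdges k n leftArc) a w) ≤
      prob p Λ fun S => ∃ m, IsJoint S (cellPathEdges k n rightArc) (cellPathEdges k n leftArc)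
        {z | cellOf n z = (0, 5)} (wall k n (0, -4) (-1, 0)) (wall k n (0, -4) (0, 1)) m := by
    refine prob_mono h0 h1 ?_
    rintro S - ⟨w, hw, ⟨a, ha, haw⟩, b, hb, hbw⟩
    exact ⟨w, hw, ⟨a, ha, haw.symm⟩, b, hb, hbw.symm⟩
  have hne : ∀ z ∈ {z | cellOf n z = (0, 5)}, z ∉ {z | cellOf n z = (0, -4)} := by
    intro z (hz : cellOf n z = (0, 5)) (hz' : cellOf n z = (0, -4))
    rw [hz] at hz'
    simp at hz'
  have hclose := prob_joint_le (B := wall k n (0, -4) (-1, 0)) (E := wall k n (0, -4) (0, 1)) hδ hp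
    hp' hΛ hr hl (hasEnd_rightArc_bottom.containsVertical n)
    (hasEnd_leftArc_bottom.containsVertical n) hne
    (fun s hs => hasEnd_rightArc_bottom.forcedCrossing hn hasEnd_leftArc_bottom
      (by rintro _ rfl; exact hne _ hs) (by rintro _ rfl; exact hne _ hs))
  have hall := (mul_le_mul hR hL (by positivity) (prob_nonneg h0 h1 _)).trans (hfkg.trans
    (htop.trans (mul_le_mul_of_nonneg_left (hjoint.trans hclose) hcost.le)))
  rw [div_le_iff₀ (pow_pos hcost 2)]
  linarith only [hall]

theorem le_real_circuitEvent {p : unitInterval} {δ c : ℝ} {n : ℕ} (hn : 0 < n) (hδ : 0 < δ)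
    (hp : δ ≤ p) (hp' : δ ≤ 1 - p) (hc : 0 ≤ c) (hcross : c ≤ crossingProb k p (2 * n) (n - 1)) :
    c * (c / (1 + surgeryCost k δ)) ^ 30 * (c * (c / (1 + surgeryCost k δ)) ^ 32) /
      (1 + surgeryCost k δ) ^ 2 ≤ (bondPercolation k p).real (circuitEvent k (3 * n)) := by
  have hfin := (finite_cellPathEdges (k := k) n hn rightArc).union
    (finite_cellPathEdges (k := k) n hn leftArc)
  -- Only the edges of the two arcs matter, so all the probability estimates are made on this finite
  -- set.
  set Λ := hfin.toFinset with hΛdef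
  have hcoe : (↑Λ : Set (Sym2 (SlabVertex k))) =
      cellPathEdges k n rightArc ∪ cellPathEdges k n leftArc := hfin.coe_toFinset
  have hΛ : ↑Λ ⊆ (slab k).edgeSet := by
    rw [hcoe]
    rintro e (he | he)
    · exact he.1
    · exact he.1
  have hmain := prob_doublyLinked (Λ := Λ) hn hδ hp hp' hc (fun x y h => hΛ h)
    (hcoe ▸ Set.subset_union_left) (hcoe ▸ Set.subset_union_right) (by
      intro a a' hsub hdir
      refine hcross.trans ((crossingProb_le_domino p hn hdir).trans ?_)
      rw [← real_eq_prob p hΛ]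
      refine measureReal_mono ?_
      rintro ω ⟨x, hx, y, hy, hxy⟩
      have hinc : openEdges ω ∩ cellPathEdges k n [a', a] ⊆
          openEdges ω ∩ ↑Λ ∩ cellPathEdges k n [a', a] :=
        Set.subset_inter (Set.inter_subset_inter_right _ hsub) Set.inter_subset_right
      exact ⟨x, hx, y, hy, hxy.mono hinc⟩)
  refine hmain.trans ?_
  rw [← real_eq_prob p hΛ]
  exact measureReal_mono fun ω hω =>
    mem_circuitEvent_of_doublyLinked hn Set.inter_subset_left hω

end Assembly

end SlabPercolation

theorem theorem3p8 (k : ℕ) (hk : 1 ≤ k) (r : ℕ) (hr : 3 ≤ r) (ε : unitInterval) (hε : 0 < ε)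
    (hsup : (⨆ n : {n : ℕ // 2 ≤ n}, crossingProb k ε (2 * (n : ℕ)) ((n : ℕ) - 1)) < 1 / 2)
    (c : ℝ) (hc : 0 < c) :
    ∃ lam : ℕ, 1 ≤ lam ∧ ∃ c' : ℝ, 0 < c' ∧
      ∀ p : unitInterval, (ε : ℝ) ≤ p → (p : ℝ) ≤ 1 - ε → ∀ n : ℕ, 4 * r ≤ n →
        c ≤ crossingProb k p (2 * n) (n - 1) →
          c' ≤ (bondPercolation k p).real (circuitEvent k (lam * n)) := by
  have hε' : (0 : ℝ) < ε := hε
  have hcost : 0 < 1 + SlabPercolation.surgeryCost k ε := by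
    have := SlabPercolation.surgeryCost_nonneg (k := k) hε'
    linarith
  -- The factor 3 is that of the annulus `A_{3n,6n}` containing both arcs. The constant left open is
  -- the bound of `le_real_circuitEvent` with `δ = ε`, which depends only on `k`, `ε` and `c`.
  refine ⟨3, by norm_num, _, ?_, fun p hp hp' n hn hcross =>
    SlabPercolation.le_real_circuitEvent (by omega) hε' hp (by linarith) hc.le hcross⟩
  positivity
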